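/- For each integer $a\ge 1$ let $b=b(a)\le 0$ be an integer and let $X^{(a)}$ be an irreducible discrete-time birth-and-death chain on $\{b,b+1,\dots,a\}\subset\mathbb Z$: from $x$ it moves to $x+1$ with probability $p_x$ and to $x-1$ with probability $q_x$, and stays at $x$ with probability $1-p_x-q_x$, where $p_x>0$ for $b\le x<a$, $p_a=0$, $q_x>0$ for $b<x\le a$ and $q_b=0$ (the $p$'s and $q$'s may depend on $a$). For a state $x$ and a set $S$ of states, $T_{x\to S}=\min\{t\ge 0: X^{(a)}(t)\in S\}$ denotes the hitting time of $S$ for the chain started at $x$, and $T_{x\to y}=T_{x\to\{y\}}$. Let $\tau_{x\to x,y}=\sup\{0<t<T_{x\to y}:X^{(a)}(t)=x\}$ ($0$ if there is no such $t$), for the chain started at $x$, and $\widetilde T_{x\to y}=T_{x\to y}-\tau_{x\to x,y}$. The family has $0^+$-SD if $\inf_{a}\inf_{1\le x\le a}q_x>0$ and $K_a^2/\mathbb E[T_{a\to 0}]\to 0$ as $a\to\infty$, where $K_a=\sup_{1\le x\le a}q_x\,\mathbb E[T_{x\to x-1}]$. It has $0^-$-SD if $\inf_{a}\inf_{b\le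 x\le -1}p_x>0$ and $K_b^2/\mathbb E[T_{b\to 0}]\to 0$ as $a\to\infty$, where $K_b=\sup_{b\le x\le -1}p_x\,\mathbb E[T_{x\to x+1}]$. It has $0$-SD if it has both. Random variables $U^{(a)}$ exhibit cut-off at mean times if $U^{(a)}/\mathbb E[U^{(a)}]\to 1$ in probability, and escape-time behavior at mean times if $U^{(a)}/\mathbb E[U^{(a)}]$ converges in law to the exponential distribution with parameter $1$, as $a\to\infty$. The family is a half well if $b=0$ for all $a$; it is a full well if $b<0$ for all sufficiently large $a$. 1. For every $a$ and all $x,y\in\{b,\dots,a\}$, $\widetilde T_{x\to y}$ and $\widetilde T_{y\to x}$ have the same law. In particular this holds for $(x,y)=(a,0)$ and for $(x,y)=(b,0)$. 2. If the family has $0^+$-SD, then $T_{a\to 0}$ exhibits cut-off at mean times. If the family is a full well with $0^-$-SD, then $T_{b\to 0}$ exhibits cut-off at mean times. 3. Let the family be a full well with $0$-SD, and consider the conditions $$\text{(i)}\ \ \frac{\mathbb E[T_{b\to 0}]}{\mathbb E[T_{0\to a}]}\to 0,\qquad \text{(ii)}\ \ \frac{\mathbb E[T_{a\to 0}]}{\mathbb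 E[T_{0\to b}]}\to 0\qquad(a\to\infty).$$ If (i) holds, then $T_{0\to a}$ exhibits escape-time behavior at mean times. If (ii) holds, then $T_{0\to b}$ exhibits escape-time behavior at mean times. If both hold, then $T_{0\to\{a,b\}}$ exhibits escape-time behavior at mean times. If the family is a half well with $0^+$-SD, then $T_{0\to a}$ exhibits escape-time behavior at mean times. -/

import Mathlib

open MeasureTheory ProbabilityTheory Filter Topology
open scoped ENNReal NNReal

/-- An irreducible birth-and-death chain on the integer interval `⟦b, a⟧`, given by its
probabilities `p x` of a step to the right and `q x` of a step to the left. Inside the interval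
they are positive exactly for the steps that stay inside; the remaining mass is the waiting
probability `r x`. By convention `p` and `q` vanish outside the interval. -/
structure BirthDeathChain (b a : ℤ) where
  /-- probability of the step `x → x + 1` -/
  p : ℤ → ℝ≥0
  /-- probability of the step `x → x - 1` -/
  q : ℤ → ℝ≥0
  p_pos_iff : ∀ x, 0 < p x ↔ b ≤ x ∧ x < a
  q_pos_iff : ∀ x, 0 < q x ↔ b < x ∧ x ≤ a
  p_add_q_le_one : ∀ x, p x + q x ≤ 1

/-- The first time `t ≥ 0` at which the trajectory `ω` is in `S` (`⊤` if there is none). -/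
noncomputable def hitTime (S : Set ℤ) (ω : ℕ → ℤ) : ℕ∞ :=
  ⨅ (t : ℕ) (_ : ω t ∈ S), (t : ℕ∞)

/-- The last time `0 < t < hitTime {y}` at which the trajectory `ω` is at `x`
(`0` if there is none). -/
noncomputable def lastVisitBefore (x y : ℤ) (ω : ℕ → ℤ) : ℕ∞ :=
  ⨆ (t : ℕ) (_ : 0 < t ∧ (t : ℕ∞) < hitTime {y} ω ∧ ω t = x), (t : ℕ∞)

/-- The time needed to hit `y` after the last visit to `x` before hitting `y`. -/
noncomputable def timeAfterLastVisit (x y : ℤ) (ω : ℕ → ℤ) : ℕ∞ :=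
  hitTime {y} ω - lastVisitBefore x y ω

namespace BirthDeathChain

variable {b a : ℤ} (X : BirthDeathChain b a)

/-- The waiting probability at `x`. -/
noncomputable def r (x : ℤ) : ℝ≥0 := 1 - (X.p x + X.q x)

/-- The law of the next position when the chain is at `x`. -/
noncomputable def stepLaw (x : ℤ) : Measure ℤ :=
  (X.p x : ℝ≥0∞) • Measure.dirac (x + 1) + (X.q x : ℝ≥0∞) • Measure.dirac (x - 1)
    + (X.r x : ℝ≥0∞) • Measure.dirac x

instance isProbabilityMeasure_stepLaw (x : ℤ) : IsProbabilityMeasure (X.stepLaw x) := by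
  constructor
  have h : X.p x + X.q x + X.r x = 1 := add_tsub_cancel_of_le (X.p_add_q_le_one x)
  simpa [stepLaw] using congrArg (fun s : ℝ≥0 => (s : ℝ≥0∞)) h

/-- The transition kernel, as a kernel from trajectories up to time `n` to positions at time
`n + 1`; it depends on the position at time `n` only. -/
noncomputable def stepKernel (n : ℕ) : Kernel ((_ : Finset.Iic n) → ℤ) ℤ :=
  (Kernel.ofFunOfCountable X.stepLaw).comap
    (fun h => h ⟨n, Finset.mem_Iic.2 le_rfl⟩) (measurable_pi_apply _)

instance isMarkovKernel_stepKernel (n : ℕ) : IsMarkovKernel (X.stepKernel n) :=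
  ⟨fun h => X.isProbabilityMeasure_stepLaw (h ⟨n, Finset.mem_Iic.2 le_rfl⟩)⟩

/-- The law, on the space of trajectories, of the chain started at `z`. -/
noncomputable def pathLaw (z : ℤ) : Measure (ℕ → ℤ) :=
  Kernel.traj (X := fun _ : ℕ => ℤ) X.stepKernel 0 (fun _ => z)

instance isProbabilityMeasure_pathLaw (z : ℤ) : IsProbabilityMeasure (X.pathLaw z) := by
  unfold pathLaw; infer_instance

/-- The mean time needed to reach `S` when the chain starts at `x`. -/
noncomputable def meanHitTime (x : ℤ) (S : Set ℤ) : ℝ≥0∞ :=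
  ∫⁻ ω, (hitTime S ω : ℝ≥0∞) ∂(X.pathLaw x)

/-- The constant `K_a = sup_{x ∈ ⟦1, a⟧} q_x E[T_{x → x - 1}]`. -/
noncomputable def rightConst : ℝ≥0∞ :=
  ⨆ x ∈ Set.Icc (1 : ℤ) a, (X.q x : ℝ≥0∞) * X.meanHitTime x {x - 1}

/-- The constant `K_b = sup_{x ∈ ⟦b, -1⟧} p_x E[T_{x → x + 1}]`. -/
noncomputable def leftConst : ℝ≥0∞ :=
  ⨆ x ∈ Set.Icc b (-1 : ℤ), (X.p x : ℝ≥0∞) * X.meanHitTime x {x + 1}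

end BirthDeathChain

/-- Strong drift to the left towards `0` (`0⁺`-SD). -/
def StrongDriftLeft {b : ℕ+ → ℤ} (X : ∀ a : ℕ+, BirthDeathChain (b a) (a : ℕ)) : Prop :=
  0 < (⨅ (a : ℕ+) (x ∈ Set.Icc (1 : ℤ) (a : ℕ)), ((X a).q x : ℝ≥0∞)) ∧
  Tendsto (fun a : ℕ+ => (X a).rightConst ^ 2 / (X a).meanHitTime (a : ℕ) {0}) atTop (𝓝 0)

/-- Strong drift to the right towards `0` (`0⁻`-SD). -/
def StrongDriftRight {b : ℕ+ → ℤ} (X : ∀ a : ℕ+, BirthDeathChain (b a) (a : ℕ)) : Prop :=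
  0 < (⨅ (a : ℕ+) (x ∈ Set.Icc (b a) (-1 : ℤ)), ((X a).p x : ℝ≥0∞)) ∧
  Tendsto (fun a : ℕ+ => (X a).leftConst ^ 2 / (X a).meanHitTime (b a) {0}) atTop (𝓝 0)

/-- The bilateral strong drift condition towards `0` (`0`-SD). -/
def StrongDrift {b : ℕ+ → ℤ} (X : ∀ a : ℕ+, BirthDeathChain (b a) (a : ℕ)) : Prop :=
  StrongDriftLeft X ∧ StrongDriftRight X

section Behaviours

variable {Ω : ℕ+ → Type*} [∀ a, MeasurableSpace (Ω a)]

/-- The random variable `U / E[U]`, for a random time `U`. -/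
noncomputable def meanNormalized {Ω : Type*} [MeasurableSpace Ω] (μ : Measure Ω) (U : Ω → ℕ∞)
    (ω : Ω) : ℝ :=
  ((U ω : ℝ≥0∞) / ∫⁻ ω', (U ω' : ℝ≥0∞) ∂μ).toReal

/-- Cut-off behaviour at mean times: `U a / E[U a]` tends to `1` in probability. -/
def CutoffAtMeanTimes (μ : ∀ a, Measure (Ω a)) (U : ∀ a, Ω a → ℕ∞) : Prop :=
  ∀ ε : ℝ, 0 < ε →
    Tendsto (fun a => μ a {ω | ε ≤ |meanNormalized (μ a) (U a) ω - 1|}) atTop (𝓝 0)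

/-- Escape-time behaviour at mean times: `V a / E[V a]` converges in law to the exponential
distribution with parameter `1`. -/
def EscapeAtMeanTimes (μ : ∀ a, Measure (Ω a)) [∀ a, IsProbabilityMeasure (μ a)]
    (V : ∀ a, Ω a → ℕ∞) : Prop :=
  haveI : IsProbabilityMeasure (expMeasure 1) := isProbabilityMeasure_expMeasure one_pos
  TendstoInDistribution (fun a => meanNormalized (μ a) (V a)) atTop (id : ℝ → ℝ) μ (expMeasure 1)

end Behaviours

/-! Write `P` for the averaging operator `avg`. By the Markov property at time one, every quantity
needed solves a linear equation in `f - P f` off a set `S` of states, and solutions are compared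
through the maximum principle (`le_of_subharmonic_sub`). The second tool is reversibility: `P` is
symmetric for the weights `m` (`sum_smul_avg`).

Equality in law. The function `z ↦ P_z(T̃ = n, T_x < T_y)` is harmonic off `{x, y}` and vanishes at
`y`, so it is a multiple of `k z = P_z(T_x < T_y)`. A first step from `x` then expresses `P_x(T̃ =
n) (1 - P k x)` as the probability of going from `x` to `y` in `n` steps without meeting `x` or `y`
in between. Multiplied by `m x`, the latter is symmetric in `x` and `y`, and so is the factor: `m x
(1 - P k x) = m y P k y`.

Cut-off. Let `f x = E T_{x → 0}`, so `f - P f = 1` off `0`. Strong drift bounds the increments of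
`f` and gives `P f² ≤ f² - 2 f + C` on the right of `0`, with `C = 2 K² / δ`
(`avg_sq_meanHit_zero_le`). Hence `f² + C f` dominates the second moment there, the variance from
`a` is at most `C f(a)`, and `C / f(a) → 0` allows Chebyshev's inequality.

Escape. The same inequality, compared with the mean time to reach `a`, gives `δ² f(a)² ≤ 2 K² E T_{0
→ a}`, so the return from `a` is negligible against the escape to `a`. Conditions (i) and (ii)
control the return from the opposite end; for the exit through either end, `le_meanHit_pair` bounds
the mean exit time from below.

It remains to show that `D / E → 0` suffices, where `D` is the largest mean return time to `0` and
`E` the mean escape time. Let `u x = E_x ζ^T` with `‖ζ‖ = 1`, and let `h x` be the probability of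
reaching `S` before `0`. Pairing `u = ζ P u` with `m (1 - h)` gives an exact formula for `1 - u 0`
in terms of the sum of `m (1 - h) u`. There `u` may be replaced by `u 0`, as `‖u - u 0‖ ≤ 2 h + ‖ζ -
1‖ f`. With `ζ = exp (i s / E)` this yields `u 0 → 1 / (1 - i s)` (`norm_one_sub_mul_le`), and
Lévy's continuity theorem concludes. -/

/-! ### Trajectories and cylinder sets -/

/-- The trajectory that starts at `x` and then follows `ω`. -/
def prepend (x : ℤ) (ω : ℕ → ℤ) : ℕ → ℤ
  | 0 => x
  | n + 1 => ω n

@[fun_prop]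
lemma measurable_prepend (x : ℤ) : Measurable (prepend x) := by
  refine measurable_pi_iff.2 fun n => ?_
  cases n with
  | zero => exact measurable_const
  | succ n => exact measurable_pi_apply n

/-- The trajectories that agree with `c` up to time `n`. -/
def pathCylinder (c : ℕ → ℤ) (n : ℕ) : Set (ℕ → ℤ) := {ω | ∀ i ≤ n, ω i = c i}

lemma measurableSet_pathCylinder (c : ℕ → ℤ) (n : ℕ) : MeasurableSet (pathCylinder c n) := by
  have : pathCylinder c n = ⋂ i ∈ Set.Iic n, (fun ω : ℕ → ℤ => ω i) ⁻¹' {c i} := by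
    ext ω; simp [pathCylinder]
  rw [this]
  exact MeasurableSet.biInter (Set.to_countable _) fun i _ =>
    measurable_pi_apply i (measurableSet_singleton _)

/-- Two probability measures on trajectories that agree on cylinders are equal. -/
lemma ext_of_pathCylinder {μ ν : Measure (ℕ → ℤ)} [IsProbabilityMeasure μ]
    [IsProbabilityMeasure ν] (h : ∀ c n, μ (pathCylinder c n) = ν (pathCylinder c n)) :
    μ = ν := by
  refine ext_of_generate_finite {s | ∃ c n, s = pathCylinder c n} ?_ ?_ ?_ (by simp)
  · apply le_antisymm
    · rw [MeasurableSpace.pi]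
      refine iSup_le fun n => ?_
      rintro _ ⟨t, -, rfl⟩
      -- There are countably many words of length `n + 1`, so an event about the coordinate `n` is a
      -- countable union of cylinders.
      have : (fun ω : ℕ → ℤ => ω n) ⁻¹' t =
          ⋃ l : {l : Fin (n + 1) → ℤ // l (Fin.last n) ∈ t},
            pathCylinder (fun i => if h : i < n + 1 then l.1 ⟨i, h⟩ else 0) n := by
        ext ω
        simp only [Set.mem_preimage, Set.mem_iUnion, pathCylinder, Set.mem_ofPred_eq]
        constructor
        · intro hω
          refine ⟨⟨fun i => ω i, by simpa using hω⟩, fun i hi => ?_⟩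
          rw [dif_pos (by omega)]
        · rintro ⟨⟨l, hl⟩, h⟩
          have := h n le_rfl
          rw [dif_pos (by omega)] at this
          rw [this]; exact hl
      rw [this]
      exact MeasurableSet.iUnion fun l => MeasurableSpace.measurableSet_generateFrom ⟨_, _, rfl⟩
    · refine MeasurableSpace.generateFrom_le ?_
      rintro _ ⟨c, n, rfl⟩
      exact measurableSet_pathCylinder c n
  -- Two cylinders with a common trajectory `ω` intersect in the cylinder of `ω` of the larger
  -- length.
  · rintro _ ⟨c, n, rfl⟩ _ ⟨d, m, rfl⟩ ⟨ω, hω1, hω2⟩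
    refine ⟨ω, max n m, ?_⟩
    ext η
    simp only [pathCylinder, Set.mem_inter_iff, Set.mem_ofPred_eq] at *
    constructor
    · rintro ⟨h1, h2⟩ i hi
      rcases le_max_iff.1 hi with hi | hi
      · rw [h1 i hi, hω1 i hi]
      · rw [h2 i hi, hω2 i hi]
    · intro h1
      exact ⟨fun i hi => by rw [h1 i (hi.trans (le_max_left _ _)), hω1 i hi],
        fun i hi => by rw [h1 i (hi.trans (le_max_right _ _)), hω2 i hi]⟩
  · rintro _ ⟨c, n, rfl⟩
    exact h c n

/-! ### The path law and the Markov property at time one -/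

namespace BirthDeathChain

variable {b a : ℤ} (X : BirthDeathChain b a)

/-- The mean of `f` after one step of the chain from `x`. -/
noncomputable def avg {M : Type*} [AddCommMonoid M] [Module ℝ≥0 M] (f : ℤ → M) (x : ℤ) : M :=
  X.p x • f (x + 1) + X.q x • f (x - 1) + X.r x • f x

lemma p_add_q_add_r (x : ℤ) : X.p x + X.q x + X.r x = 1 :=
  add_tsub_cancel_of_le (X.p_add_q_le_one x)

lemma pathLaw_pathCylinder_zero (z : ℤ) (c : ℕ → ℤ) :
    X.pathLaw z (pathCylinder c 0) = if c 0 = z then 1 else 0 := by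
  have h := Kernel.traj_map_frestrictLe_apply (X := fun _ : ℕ => ℤ) (κ := X.stepKernel)
    0 0 (fun _ => z)
  rw [Kernel.partialTraj_self, Kernel.id_apply] at h
  have hc : pathCylinder c 0 = Preorder.frestrictLe (π := fun _ : ℕ => ℤ) 0 ⁻¹'
      {fun _ => c 0} := by
    ext ω
    simp only [pathCylinder, nonpos_iff_eq_zero, forall_eq, Set.mem_ofPred_eq, Set.mem_preimage,
      Set.mem_singleton_iff]
    constructor
    · intro h
      ext ⟨i, hi⟩
      have : i = 0 := by simpa using hi
      subst this
      exact h
    · intro h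
      exact congrFun h ⟨0, by simp⟩
  rw [hc, ← Measure.map_apply (by fun_prop) (measurableSet_singleton _)]
  unfold pathLaw
  rw [h, Measure.dirac_apply' _ (measurableSet_singleton _)]
  simp only [Set.indicator_apply, Set.mem_singleton_iff, Pi.one_apply]
  congr 1
  rw [eq_iff_iff]
  constructor
  · intro h; exact (congrFun h ⟨0, by simp⟩).symm
  · intro h; rw [h]

lemma pathLaw_pathCylinder_succ (z : ℤ) (c : ℕ → ℤ) (n : ℕ) :
    X.pathLaw z (pathCylinder c (n + 1)) =
      X.pathLaw z (pathCylinder c n) * X.stepLaw (c n) {c (n + 1)} := by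
  have h := Kernel.partialTraj_compProd_eq_map_traj (X := fun _ : ℕ => ℤ) (κ := X.stepKernel)
    (Nat.zero_le n) (x₀ := fun _ => z)
  have hc : pathCylinder c n = Preorder.frestrictLe (π := fun _ : ℕ => ℤ) n ⁻¹'
      {Preorder.frestrictLe (π := fun _ : ℕ => ℤ) n c} := by
    ext ω
    simp only [pathCylinder, Set.mem_ofPred_eq, Set.mem_preimage, Set.mem_singleton_iff]
    constructor
    · intro h
      ext ⟨i, hi⟩
      exact h i (by simpa using hi)
    · intro h i hi
      exact congrFun h ⟨i, by simpa using hi⟩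
  have hc' : pathCylinder c (n + 1) = (fun x : ℕ → ℤ =>
      (Preorder.frestrictLe (π := fun _ : ℕ => ℤ) n x, x (n + 1))) ⁻¹'
        ({Preorder.frestrictLe (π := fun _ : ℕ => ℤ) n c} ×ˢ {c (n + 1)}) := by
    have : pathCylinder c (n + 1) = pathCylinder c n ∩ {ω | ω (n + 1) = c (n + 1)} := by
      ext ω
      simp only [pathCylinder, Set.mem_inter_iff, Set.mem_ofPred_eq]
      constructor
      · exact fun h => ⟨fun i hi => h i (by omega), h _ le_rfl⟩
      · rintro ⟨h1, h2⟩ i hi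
        rcases Nat.lt_or_eq_of_le hi with h | rfl
        · exact h1 i (by omega)
        · exact h2
    rw [this, hc]
    ext ω
    simp
  rw [hc', ← Measure.map_apply (by fun_prop)
    ((measurableSet_singleton _).prod (measurableSet_singleton _))]
  unfold pathLaw
  rw [← h, Measure.compProd_apply_prod (measurableSet_singleton _) (measurableSet_singleton _),
    Measure.restrict_singleton, lintegral_smul_measure, lintegral_dirac, smul_eq_mul,
    ← Kernel.traj_map_frestrictLe_apply, Measure.map_apply (by fun_prop)
    (measurableSet_singleton _), ← hc]
  rfl

lemma pathLaw_pathCylinder (z : ℤ) (c : ℕ → ℤ) (n : ℕ) :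
    X.pathLaw z (pathCylinder c n) = (if c 0 = z then 1 else 0) *
      ∏ i ∈ Finset.range n, X.stepLaw (c i) {c (i + 1)} := by
  induction n with
  | zero => simp [pathLaw_pathCylinder_zero]
  | succ n ih => rw [pathLaw_pathCylinder_succ, ih, Finset.prod_range_succ, mul_assoc]

lemma stepLaw_singleton (x y : ℤ) : X.stepLaw x {y} =
    X.avg (fun z => if y = z then (1 : ℝ≥0∞) else 0) x := by
  simp [stepLaw, avg, Set.indicator_apply, eq_comm]

/-- The Markov property at time one. -/
theorem pathLaw_eq_map_prepend (x : ℤ) :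
    X.pathLaw x = (X.avg X.pathLaw x).map (prepend x) := by
  have : IsProbabilityMeasure (X.avg X.pathLaw x) := by
    constructor
    have h := X.p_add_q_add_r x
    simpa [avg, -Measure.coe_nnreal_smul, ENNReal.smul_def] using
      congrArg (fun s : ℝ≥0 => (s : ℝ≥0∞)) h
  have : IsProbabilityMeasure ((X.avg X.pathLaw x).map (prepend x)) :=
    Measure.isProbabilityMeasure_map (by fun_prop)
  refine ext_of_pathCylinder fun c n => ?_
  rw [Measure.map_apply (by fun_prop) (measurableSet_pathCylinder c n), pathLaw_pathCylinder]
  by_cases hx : c 0 = x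
  swap
  · have : prepend x ⁻¹' pathCylinder c n = ∅ := by
      ext ω
      simp only [pathCylinder, Set.mem_preimage, Set.mem_ofPred_eq, Set.mem_empty_iff_false,
        iff_false, not_forall]
      exact ⟨0, Nat.zero_le _, fun h => hx h.symm⟩
    simp [hx, this]
  cases n with
  | zero =>
    have : prepend x ⁻¹' pathCylinder c 0 = Set.univ := by
      ext ω; simp [pathCylinder, hx, prepend]
    simp [hx, this]
  | succ n =>
    have : prepend x ⁻¹' pathCylinder c (n + 1) = pathCylinder (fun i => c (i + 1)) n := by
      ext ω
      simp only [pathCylinder, Set.mem_preimage, Set.mem_ofPred_eq]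
      constructor
      · exact fun h i hi => h (i + 1) (by omega)
      · rintro h (_ | i) hi
        · exact hx.symm
        · exact h i (by omega)
    rw [this, Finset.prod_range_succ', hx]
    simp only [avg, Measure.add_apply, Measure.smul_apply, pathLaw_pathCylinder, zero_add,
      stepLaw_singleton, if_true, one_mul, ENNReal.smul_def, smul_eq_mul]
    ring

lemma lintegral_pathLaw (x : ℤ) {F : (ℕ → ℤ) → ℝ≥0∞} (hF : Measurable F) :
    ∫⁻ ω, F ω ∂X.pathLaw x = X.avg (fun y => ∫⁻ ω, F (prepend x ω) ∂X.pathLaw y) x := by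
  rw [pathLaw_eq_map_prepend, lintegral_map hF (by fun_prop)]
  simp only [avg, lintegral_add_measure, lintegral_smul_measure]

lemma integral_pathLaw {E : Type*} [NormedAddCommGroup E] [NormedSpace ℝ E] (x : ℤ)
    {F : (ℕ → ℤ) → E} (hF : StronglyMeasurable F) {C : ℝ} (hC : ∀ ω, ‖F ω‖ ≤ C) :
    ∫ ω, F ω ∂X.pathLaw x = X.avg (fun y => ∫ ω, F (prepend x ω) ∂X.pathLaw y) x := by
  have hi : ∀ y, Integrable (fun ω => F (prepend x ω)) (X.pathLaw y) := fun y =>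
    Integrable.of_bound (hF.comp_measurable (measurable_prepend x)).aestronglyMeasurable C
      (Eventually.of_forall fun ω => hC _)
  rw [pathLaw_eq_map_prepend, integral_map (by fun_prop) hF.aestronglyMeasurable]
  simp only [avg]
  rw [integral_add_measure, integral_add_measure, integral_smul_nnreal_measure,
    integral_smul_nnreal_measure, integral_smul_nnreal_measure]
  all_goals first
    | exact (hi _).smul_measure_nnreal
    | exact (hi _).smul_measure_nnreal.add_measure (hi _).smul_measure_nnreal

lemma pathLaw_apply (x : ℤ) {A : Set (ℕ → ℤ)} (hA : MeasurableSet A) :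
    X.pathLaw x A = X.avg (fun y => X.pathLaw y (prepend x ⁻¹' A)) x := by
  rw [pathLaw_eq_map_prepend, Measure.map_apply (by fun_prop) hA]
  simp [avg]

lemma real_pathLaw_apply (x : ℤ) {A : Set (ℕ → ℤ)} (hA : MeasurableSet A) :
    (X.pathLaw x).real A = X.avg (fun y => (X.pathLaw y).real (prepend x ⁻¹' A)) x := by
  simp only [Measure.real, pathLaw_apply X x hA, avg]
  rw [ENNReal.toReal_add, ENNReal.toReal_add]
  · simp [ENNReal.smul_def, NNReal.smul_def]
  all_goals simp [ENNReal.smul_def, ENNReal.mul_eq_top]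

end BirthDeathChain

/-! ### Hitting times: behaviour under `prepend` and measurability -/

lemma le_hitTime_iff {S : Set ℤ} {ω : ℕ → ℤ} {n : ℕ} :
    (n : ℕ∞) ≤ hitTime S ω ↔ ∀ m < n, ω m ∉ S := by
  simp only [hitTime, le_iInf_iff, Nat.cast_le]
  exact ⟨fun h m hm hS => absurd (h m hS) (by omega),
    fun h m hS => not_lt.1 fun hm => h m hm hS⟩

lemma hitTime_lt_iff {S : Set ℤ} {ω : ℕ → ℤ} {n : ℕ} :
    hitTime S ω < n ↔ ∃ m < n, ω m ∈ S := by
  rw [← not_le, le_hitTime_iff]; push Not; rfl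

lemma hitTime_prepend_of_mem {S : Set ℤ} {x : ℤ} (hx : x ∈ S) (ω : ℕ → ℤ) :
    hitTime S (prepend x ω) = 0 := by
  refine le_antisymm ?_ zero_le
  exact iInf₂_le_of_le 0 hx le_rfl

lemma hitTime_prepend_of_notMem {S : Set ℤ} {x : ℤ} (hx : x ∉ S) (ω : ℕ → ℤ) :
    hitTime S (prepend x ω) = hitTime S ω + 1 := by
  refine ENat.eq_of_forall_natCast_le_iff fun n => ?_
  cases n with
  | zero => simp
  | succ n =>
    rw [le_hitTime_iff, Nat.cast_succ, ENat.add_le_add_iff_right ENat.one_ne_top,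
      le_hitTime_iff]
    constructor
    · exact fun h m hm => h (m + 1) (by omega)
    · rintro h (_ | m) hm
      · exact hx
      · exact h m (by omega)

lemma borelSpace_enat : BorelSpace ℕ∞ := by
  constructor
  refine (eq_top_iff.2 fun s _ => ?_).symm
  borelize ℕ∞
  exact s.to_countable.measurableSet

@[fun_prop]
lemma measurable_hitTime (S : Set ℤ) : Measurable (hitTime S) := by
  have := borelSpace_enat
  unfold hitTime
  refine Measurable.iInf fun t => ?_
  have : (fun ω : ℕ → ℤ => ⨅ (_ : ω t ∈ S), (t : ℕ∞)) = fun ω => open Classical in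
      if ω t ∈ S then (t : ℕ∞) else ⊤ := by
    ext ω; split_ifs with h <;> simp [h]
  rw [this]
  refine Measurable.ite ?_ measurable_const measurable_const
  exact measurable_pi_apply t (.of_discrete)

@[fun_prop]
lemma measurable_lastVisitBefore (x y : ℤ) : Measurable (lastVisitBefore x y) := by
  have := borelSpace_enat
  unfold lastVisitBefore
  refine Measurable.iSup fun t => ?_
  have : (fun ω : ℕ → ℤ => ⨆ (_ : 0 < t ∧ (t : ℕ∞) < hitTime {y} ω ∧ ω t = x), (t : ℕ∞)) =
      fun ω => open Classical in
      if 0 < t ∧ (t : ℕ∞) < hitTime {y} ω ∧ ω t = x then (t : ℕ∞) else 0 := by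
    ext ω; split_ifs with h <;> simp [h]
  rw [this]
  refine Measurable.ite ?_ measurable_const measurable_const
  refine (MeasurableSet.const _).inter (MeasurableSet.inter ?_ ?_)
  · exact measurableSet_lt measurable_const (measurable_hitTime _)
  · exact measurableSet_eq_fun (measurable_pi_apply t) measurable_const

@[fun_prop]
lemma measurable_timeAfterLastVisit (x y : ℤ) : Measurable (timeAfterLastVisit x y) := by
  have : timeAfterLastVisit x y = (fun p : ℕ∞ × ℕ∞ => p.1 - p.2) ∘
      fun ω => (hitTime {y} ω, lastVisitBefore x y ω) := rfl
  rw [this]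
  exact Measurable.of_discrete.comp (by fun_prop)

/-! ### Maximum principle and Dirichlet problem -/

namespace BirthDeathChain

variable {b a : ℤ} (X : BirthDeathChain b a)

lemma p_eq_zero_of_le {x : ℤ} (hx : a ≤ x) : X.p x = 0 := by
  by_contra h
  have := (X.p_pos_iff x).1 (pos_iff_ne_zero.2 h)
  omega

lemma q_eq_zero_of_le {x : ℤ} (hx : x ≤ b) : X.q x = 0 := by
  by_contra h
  have := (X.q_pos_iff x).1 (pos_iff_ne_zero.2 h)
  omega

lemma coe_r (x : ℤ) : (X.r x : ℝ) = 1 - X.p x - X.q x := by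
  have := X.p_add_q_add_r x
  have : (X.p x : ℝ) + X.q x + X.r x = 1 := by exact_mod_cast this
  linarith

lemma avg_real (f : ℤ → ℝ) (x : ℤ) :
    X.avg f x = X.p x * f (x + 1) + X.q x * f (x - 1) + X.r x * f x := by
  simp [avg, NNReal.smul_def]

lemma avg_complex (f : ℤ → ℂ) (x : ℤ) :
    X.avg f x = (X.p x : ℝ) * f (x + 1) + (X.q x : ℝ) * f (x - 1) + (X.r x : ℝ) * f x := by
  simp [avg, NNReal.smul_def]

lemma avg_ennreal (f : ℤ → ℝ≥0∞) (x : ℤ) :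
    X.avg f x = X.p x * f (x + 1) + X.q x * f (x - 1) + X.r x * f x := by
  simp [avg, ENNReal.smul_def]

/-- Since `p` vanishes at `a` and `q` at `b`, the average at a state never reads values outside the
interval, where functions are arbitrary. -/
lemma avg_congr {M : Type*} [AddCommMonoid M] [Module ℝ≥0 M] {f g : ℤ → M}
    (h : ∀ y ∈ Set.Icc b a, f y = g y) {x : ℤ} (hx : x ∈ Set.Icc b a) :
    X.avg f x = X.avg g x := by
  unfold avg
  rw [h x hx]
  congr 2
  · rcases lt_or_ge x a with h' | h'
    · rw [h _ ⟨by linarith [hx.1], h'⟩]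
    · simp [X.p_eq_zero_of_le h']
  · rcases lt_or_ge b x with h' | h'
    · rw [h _ ⟨by omega, by linarith [hx.2]⟩]
    · simp [X.q_eq_zero_of_le h']

lemma avg_mono_real {f g : ℤ → ℝ} (h : ∀ y ∈ Set.Icc b a, f y ≤ g y) {x : ℤ}
    (hx : x ∈ Set.Icc b a) : X.avg f x ≤ X.avg g x := by
  -- Only the values in the interval matter, and `min f g ≤ g` holds everywhere.
  have : X.avg f x = X.avg (fun y => min (f y) (g y)) x :=
    X.avg_congr (fun y hy => (min_eq_left (h y hy)).symm) hx
  rw [this, avg_real, avg_real]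
  gcongr <;> exact min_le_right _ _

lemma avg_mono_ennreal {f g : ℤ → ℝ≥0∞} (h : ∀ y ∈ Set.Icc b a, f y ≤ g y) {x : ℤ}
    (hx : x ∈ Set.Icc b a) : X.avg f x ≤ X.avg g x := by
  have : X.avg f x = X.avg (fun y => min (f y) (g y)) x :=
    X.avg_congr (fun y hy => (min_eq_left (h y hy)).symm) hx
  rw [this, avg_ennreal, avg_ennreal]
  gcongr <;> exact min_le_right _ _

lemma avg_nonneg {f : ℤ → ℝ} (h : ∀ y, 0 ≤ f y) (x : ℤ) : 0 ≤ X.avg f x := by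
  rw [avg_real]
  have h1 := h (x + 1)
  have h2 := h (x - 1)
  have h3 := h x
  positivity

lemma avg_const {M : Type*} [AddCommMonoid M] [Module ℝ≥0 M] (c : M) (x : ℤ) :
    X.avg (fun _ => c) x = c := by
  simp only [avg, ← add_smul, p_add_q_add_r, one_smul]

lemma avg_add {M : Type*} [AddCommMonoid M] [Module ℝ≥0 M] (f g : ℤ → M) (x : ℤ) :
    X.avg (fun y => f y + g y) x = X.avg f x + X.avg g x := by
  simp only [avg, smul_add]; abel

lemma avg_sub {M : Type*} [AddCommGroup M] [Module ℝ≥0 M] (f g : ℤ → M) (x : ℤ) :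
    X.avg (fun y => f y - g y) x = X.avg f x - X.avg g x := by
  simp only [avg, smul_sub]; abel

lemma avg_const_mul (c : ℝ) (f : ℤ → ℝ) (x : ℤ) :
    X.avg (fun y => c * f y) x = c * X.avg f x := by
  simp only [avg_real]; ring

lemma avg_neg (f : ℤ → ℝ) (x : ℤ) : X.avg (fun y => -f y) x = -X.avg f x := by
  simp only [avg_real]; ring

/-- The maximum principle: a function that is subharmonic off `S` and nonpositive on `S` is
nonpositive. -/
theorem le_zero_of_subharmonic {S : Set ℤ} (hS : (S ∩ Set.Icc b a).Nonempty) {w : ℤ → ℝ}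
    (hw : ∀ x ∈ Set.Icc b a, x ∉ S → w x ≤ X.avg w x)
    (hwS : ∀ x ∈ Set.Icc b a, x ∈ S → w x ≤ 0) : ∀ x ∈ Set.Icc b a, w x ≤ 0 := by
  obtain ⟨s, hsS, hs⟩ := hS
  obtain ⟨x₀, hx₀, hmax⟩ := Set.exists_max_image (Set.Icc b a) w (Set.finite_Icc b a) ⟨s, hs⟩
  by_contra! hcon
  obtain ⟨z, hz, hz0⟩ := hcon
  have hpos : 0 < w x₀ := hz0.trans_le (hmax z hz)
  -- A positive maximum is attained off `S`. There the value is at most an average of values that do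
  -- not exceed it, so every neighbour reached with positive probability has the same value; it thus
  -- spreads over the interval up to a point of `S`.
  have key : ∀ x ∈ Set.Icc b a, w x = w x₀ →
      (x + 1 ≤ a → w (x + 1) = w x₀) ∧ (b ≤ x - 1 → w (x - 1) = w x₀) := by
    intro x hx hxw
    have hxS : x ∉ S := fun h => by linarith [hwS x hx h]
    have h1 := hw x hx hxS
    rw [avg_real, X.coe_r, hxw] at h1
    have hp : (X.p x : ℝ) * (w (x + 1) - w x₀) ≤ 0 := by
      rcases lt_or_ge x a with h' | h'
      · exact mul_nonpos_of_nonneg_of_nonpos (by positivity)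
          (sub_nonpos.2 (hmax _ ⟨by linarith [hx.1], h'⟩))
      · simp [X.p_eq_zero_of_le h']
    have hq : (X.q x : ℝ) * (w (x - 1) - w x₀) ≤ 0 := by
      rcases lt_or_ge b x with h' | h'
      · exact mul_nonpos_of_nonneg_of_nonpos (by positivity)
          (sub_nonpos.2 (hmax _ ⟨by omega, by linarith [hx.2]⟩))
      · simp [X.q_eq_zero_of_le h']
    constructor
    · intro h'
      have : (0 : ℝ) < X.p x := by exact_mod_cast (X.p_pos_iff x).2 ⟨hx.1, h'⟩
      have h0 : (X.p x : ℝ) * (w (x + 1) - w x₀) = 0 := by nlinarith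
      have := (mul_eq_zero.1 h0).resolve_left this.ne'
      linarith
    · intro h'
      have : (0 : ℝ) < X.q x := by exact_mod_cast (X.q_pos_iff x).2 ⟨by omega, hx.2⟩
      have h0 : (X.q x : ℝ) * (w (x - 1) - w x₀) = 0 := by nlinarith
      have := (mul_eq_zero.1 h0).resolve_left this.ne'
      linarith
  have hup : ∀ x, x₀ ≤ x → x ≤ a → w x = w x₀ := by
    intro x hx
    induction x, hx using Int.leInduction with
    | base => intro; rfl
    | succ n hn ih =>
      intro h
      exact (key n ⟨hx₀.1.trans hn, by omega⟩ (ih (by omega))).1 h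
  have hdown : ∀ x, x ≤ x₀ → b ≤ x → w x = w x₀ := by
    intro x hx
    induction x, hx using Int.leInductionDown with
    | base => intro; rfl
    | pred n hn ih =>
      intro h
      exact (key n ⟨by omega, hn.trans hx₀.2⟩ (ih (by omega))).2 h
  have : w s = w x₀ := by
    rcases le_total x₀ s with h | h
    · exact hup s h hs.2
    · exact hdown s h hs.1
  linarith [hwS s hs hsS]

/-- Comparison principle behind the estimates on means: order the defects `f - avg f` off `S` and
the values on `S`. -/
lemma le_of_subharmonic_sub {S : Set ℤ} (hS : (S ∩ Set.Icc b a).Nonempty) {f g : ℤ → ℝ}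
    (h : ∀ x ∈ Set.Icc b a, x ∉ S → f x - X.avg f x ≤ g x - X.avg g x)
    (hfg : ∀ x ∈ Set.Icc b a, x ∈ S → f x ≤ g x) : ∀ x ∈ Set.Icc b a, f x ≤ g x := by
  intro x hx
  have := X.le_zero_of_subharmonic hS (w := fun x => f x - g x)
    (fun x hx hxS => by rw [avg_sub]; linarith [h x hx hxS])
    (fun x hx hxS => by linarith [hfg x hx hxS]) x hx
  linarith

/-- The Dirichlet problem off a nonempty set of states is solvable. -/
theorem exists_dirichlet {S : Set ℤ} (hS : (S ∩ Set.Icc b a).Nonempty) (g φ : ℤ → ℝ) :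
    ∃ f : ℤ → ℝ, (∀ x ∈ Set.Icc b a, x ∉ S → f x - X.avg f x = g x) ∧
      ∀ x ∈ Set.Icc b a, x ∈ S → f x = φ x := by
  classical
  let ext : (Set.Icc b a → ℝ) →ₗ[ℝ] (ℤ → ℝ) :=
    { toFun := fun f x => if h : x ∈ Set.Icc b a then f ⟨x, h⟩ else 0
      map_add' := fun f g => by ext x; simp only [Pi.add_apply]; split_ifs <;> simp
      map_smul' := fun c f => by ext x; simp only [Pi.smul_apply]; split_ifs <;> simp }
  have hext : ∀ f (x : Set.Icc b a), ext f x = f x := fun f x => by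
    simp only [ext, LinearMap.coe_mk, AddHom.coe_mk]
    rw [dif_pos x.2]
  let A : (Set.Icc b a → ℝ) →ₗ[ℝ] (Set.Icc b a → ℝ) :=
    { toFun := fun f x => if (x : ℤ) ∈ S then f x else f x - X.avg (ext f) x
      map_add' := fun f g => by
        ext x
        simp only [Pi.add_apply, map_add, avg_real]
        split_ifs <;> ring
      map_smul' := fun c f => by
        ext x
        simp only [Pi.smul_apply, map_smul, avg_real, smul_eq_mul, RingHom.id_apply]
        split_ifs <;> ring }
  have hA : ∀ f x, A f x = if (x : ℤ) ∈ S then f x else f x - X.avg (ext f) x := fun _ _ => rfl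
  -- The maximum principle applied to a kernel element and to its negative shows that it vanishes;
  -- in finite dimension injectivity gives solvability.
  have hinj : Function.Injective A := by
    rw [← LinearMap.ker_eq_bot, LinearMap.ker_eq_bot']
    intro f hf
    have hf' : ∀ x ∈ Set.Icc b a, (x ∈ S → ext f x = 0) ∧
        (x ∉ S → ext f x - X.avg (ext f) x = 0) := by
      intro x hx
      have h := congrFun hf ⟨x, hx⟩
      rw [hA, ← hext f ⟨x, hx⟩] at h
      constructor
      · intro hxS; rwa [if_pos hxS] at h
      · intro hxS; rwa [if_neg hxS] at h
    have h1 := X.le_zero_of_subharmonic hS (w := ext f)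
      (fun x hx hxS => by linarith [(hf' x hx).2 hxS]) (fun x hx hxS => ((hf' x hx).1 hxS).le)
    have h2 := X.le_zero_of_subharmonic hS (w := fun y => -ext f y)
      (fun x hx hxS => by rw [avg_neg]; linarith [(hf' x hx).2 hxS])
      (fun x hx hxS => by linarith [((hf' x hx).1 hxS)])
    ext x
    have h3 := h1 x x.2
    have h4 := h2 x x.2
    rw [hext] at h3 h4
    simpa using le_antisymm h3 (by linarith)
  obtain ⟨f, hf⟩ := (LinearMap.injective_iff_surjective.1 hinj)
    (fun x => if (x : ℤ) ∈ S then φ x else g x)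
  refine ⟨ext f, fun x hx hxS => ?_, fun x hx hxS => ?_⟩
  · have h := congrFun hf ⟨x, hx⟩
    rwa [hA, if_neg hxS, if_neg hxS, ← hext f ⟨x, hx⟩] at h
  · have h := congrFun hf ⟨x, hx⟩
    rwa [hA, if_pos hxS, if_pos hxS, ← hext f ⟨x, hx⟩] at h

lemma ofReal_avg {g : ℤ → ℝ} (hg : ∀ x ∈ Set.Icc b a, 0 ≤ g x) {x : ℤ} (hx : x ∈ Set.Icc b a) :
    X.avg (fun y => ENNReal.ofReal (g y)) x = ENNReal.ofReal (X.avg g x) := by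
  have h1 : X.avg g x = X.avg (fun y => max (g y) 0) x :=
    X.avg_congr (fun y hy => (max_eq_left (hg y hy)).symm) hx
  rw [h1, avg_real, avg_ennreal, ENNReal.ofReal_add, ENNReal.ofReal_add, ENNReal.ofReal_mul,
    ENNReal.ofReal_mul, ENNReal.ofReal_mul]
  · simp
  all_goals positivity

lemma toReal_avg {g : ℤ → ℝ≥0∞} (hg : ∀ x ∈ Set.Icc b a, g x ≠ ⊤) {x : ℤ}
    (hx : x ∈ Set.Icc b a) : (X.avg g x).toReal = X.avg (fun y => (g y).toReal) x := by
  have h1 : X.avg g x = X.avg (fun y => ENNReal.ofReal (g y).toReal) x :=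
    X.avg_congr (fun y hy => (ENNReal.ofReal_toReal (hg y hy)).symm) hx
  rw [h1, ofReal_avg X (fun _ _ => ENNReal.toReal_nonneg) hx, ENNReal.toReal_ofReal]
  rw [avg_real]; positivity

/-! ### Moments of hitting times -/

/-- Truncation at `n` allows an induction on time before the mean is known to be finite: each step
costs one unit of time, paid for by the defect of `g`. -/
lemma lintegral_min_hitTime_le {S : Set ℤ} {g : ℤ → ℝ} (hg0 : ∀ x ∈ Set.Icc b a, 0 ≤ g x)
    (hg : ∀ x ∈ Set.Icc b a, x ∉ S → 1 ≤ g x - X.avg g x) (n : ℕ) :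
    ∀ x ∈ Set.Icc b a, ∫⁻ ω, (min (hitTime S ω) n : ℕ∞) ∂X.pathLaw x ≤ ENNReal.ofReal (g x) := by
  induction n with
  | zero => intro x hx; simp
  | succ n ih =>
    intro x hx
    rw [lintegral_pathLaw X x (by fun_prop)]
    by_cases hxS : x ∈ S
    · simp [hitTime_prepend_of_mem hxS, avg]
    · have : ∀ ω, ((min (hitTime S (prepend x ω)) (n + 1 : ℕ) : ℕ∞) : ℝ≥0∞) =
          (min (hitTime S ω) n : ℕ∞) + 1 := by
        intro ω
        rw [hitTime_prepend_of_notMem hxS, Nat.cast_succ, min_add_add_right]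
        simp
      simp only [this]
      calc X.avg (fun y => ∫⁻ ω, (((min (hitTime S ω) n : ℕ∞) : ℝ≥0∞) + 1) ∂X.pathLaw y) x
          ≤ X.avg (fun y => ENNReal.ofReal (g y + 1)) x := by
            refine X.avg_mono_ennreal (fun y hy => ?_) hx
            rw [lintegral_add_right _ measurable_const, ENNReal.ofReal_add (hg0 y hy) zero_le_one]
            simpa using ih y hy
        _ = ENNReal.ofReal (X.avg g x + 1) := by
            rw [ofReal_avg X (fun y hy => by linarith [hg0 y hy]) hx, avg_add, avg_const]
        _ ≤ ENNReal.ofReal (g x) := ENNReal.ofReal_le_ofReal (by linarith [hg x hx hxS])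

lemma lintegral_le_of_min_le {μ : Measure (ℕ → ℤ)} {S : Set ℤ} {c : ℝ≥0∞} (k : ℕ)
    (h : ∀ n : ℕ, ∫⁻ ω, ((min (hitTime S ω) n : ℕ∞) : ℝ≥0∞) ^ k ∂μ ≤ c) :
    ∫⁻ ω, (hitTime S ω : ℝ≥0∞) ^ k ∂μ ≤ c := by
  refine le_of_tendsto' (lintegral_tendsto_of_tendsto_of_monotone
    (f := fun (n : ℕ) ω => ((min (hitTime S ω) n : ℕ∞) : ℝ≥0∞) ^ k) (fun n => by fun_prop) ?_ ?_) h
  · refine Eventually.of_forall fun ω n m hnm => ?_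
    dsimp only
    gcongr
  · refine Eventually.of_forall fun ω => ?_
    have : Tendsto (fun n : ℕ => ((min (hitTime S ω) n : ℕ∞) : ℝ≥0∞)) atTop
        (𝓝 (hitTime S ω : ℝ≥0∞)) := by
      have h1 : Tendsto (fun n : ℕ => min (hitTime S ω : ℝ≥0∞) (n : ℝ≥0∞)) atTop
          (𝓝 (min (hitTime S ω : ℝ≥0∞) ⊤)) :=
        tendsto_const_nhds.min ENNReal.tendsto_nat_nhds_top
      simpa using h1
    exact ((ENNReal.continuous_pow k).tendsto _).comp this

lemma meanHitTime_le {S : Set ℤ} {g : ℤ → ℝ} (hg0 : ∀ x ∈ Set.Icc b a, 0 ≤ g x)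
    (hg : ∀ x ∈ Set.Icc b a, x ∉ S → 1 ≤ g x - X.avg g x) {x : ℤ} (hx : x ∈ Set.Icc b a) :
    X.meanHitTime x S ≤ ENNReal.ofReal (g x) := by
  have := lintegral_le_of_min_le (S := S) (μ := X.pathLaw x) 1 (c := ENNReal.ofReal (g x))
    (fun n => by simpa using X.lintegral_min_hitTime_le hg0 hg n x hx)
  simpa [meanHitTime] using this

/-- The same induction for second moments: `(T + 1)² = T² + 2 T + 1`, so one step costs `2 * avg g +
1`. -/
lemma lintegral_sq_hitTime_le {S : Set ℤ} {g g₂ : ℤ → ℝ} (hg0 : ∀ x ∈ Set.Icc b a, 0 ≤ g x)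
    (hg : ∀ x ∈ Set.Icc b a, x ∉ S → 1 ≤ g x - X.avg g x)
    (hg20 : ∀ x ∈ Set.Icc b a, 0 ≤ g₂ x)
    (hg2 : ∀ x ∈ Set.Icc b a, x ∉ S → 2 * X.avg g x + 1 ≤ g₂ x - X.avg g₂ x) {x : ℤ}
    (hx : x ∈ Set.Icc b a) :
    ∫⁻ ω, (hitTime S ω : ℝ≥0∞) ^ 2 ∂X.pathLaw x ≤ ENNReal.ofReal (g₂ x) := by
  refine lintegral_le_of_min_le 2 fun n => ?_
  induction n generalizing x with
  | zero => simp
  | succ n ih =>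
    rw [lintegral_pathLaw X x (by fun_prop)]
    by_cases hxS : x ∈ S
    · simp [hitTime_prepend_of_mem hxS, avg]
    · have : ∀ ω, ((min (hitTime S (prepend x ω)) (n + 1 : ℕ) : ℕ∞) : ℝ≥0∞) ^ 2 =
          ((min (hitTime S ω) n : ℕ∞) : ℝ≥0∞) ^ 2 + (2 * (min (hitTime S ω) n : ℕ∞) + 1) := by
        intro ω
        rw [hitTime_prepend_of_notMem hxS, Nat.cast_succ, min_add_add_right]
        simp only [ENat.toENNReal_add, ENat.toENNReal_one]
        ring
      simp only [this]
      calc X.avg (fun y => ∫⁻ ω, (((min (hitTime S ω) n : ℕ∞) : ℝ≥0∞) ^ 2 +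
              (2 * (min (hitTime S ω) n : ℕ∞) + 1)) ∂X.pathLaw y) x
          ≤ X.avg (fun y => ENNReal.ofReal (g₂ y + (2 * g y + 1))) x := by
            refine X.avg_mono_ennreal (fun y hy => ?_) hx
            rw [lintegral_add_right _ (by fun_prop), lintegral_add_right _ measurable_const,
              lintegral_const_mul _ (by fun_prop), ENNReal.ofReal_add (hg20 y hy)
              (by linarith [hg0 y hy]), ENNReal.ofReal_add (by linarith [hg0 y hy]) zero_le_one,
              ENNReal.ofReal_mul zero_le_two]
            have := X.lintegral_min_hitTime_le hg0 hg n y hy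
            gcongr
            · exact ih hy
            · simp
            · simp
        _ = ENNReal.ofReal (X.avg g₂ x + (2 * X.avg g x + 1)) := by
            rw [ofReal_avg X (fun y hy => by linarith [hg0 y hy, hg20 y hy]) hx, avg_add, avg_add,
              avg_const, avg_const_mul]
        _ ≤ ENNReal.ofReal (g₂ x) := ENNReal.ofReal_le_ofReal (by linarith [hg2 x hx hxS])

lemma meanHitTime_of_mem {S : Set ℤ} {x : ℤ} (hx : x ∈ S) : X.meanHitTime x S = 0 := by
  rw [meanHitTime, lintegral_pathLaw X x (by fun_prop)]
  simp [hitTime_prepend_of_mem hx, avg]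

lemma meanHitTime_of_notMem {S : Set ℤ} {x : ℤ} (hx : x ∉ S) :
    X.meanHitTime x S = X.avg (fun y => X.meanHitTime y S) x + 1 := by
  rw [meanHitTime, lintegral_pathLaw X x (by fun_prop)]
  simp only [hitTime_prepend_of_notMem hx, ENat.toENNReal_add, ENat.toENNReal_one]
  have : ∀ y, ∫⁻ ω, ((hitTime S ω : ℝ≥0∞) + 1) ∂X.pathLaw y = X.meanHitTime y S + 1 := fun y => by
    rw [lintegral_add_right _ measurable_const, lintegral_one, measure_univ]; rfl
  simp only [this, avg_add, avg_const]

lemma meanHitTime_ne_top {S : Set ℤ} (hS : (S ∩ Set.Icc b a).Nonempty) {x : ℤ}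
    (hx : x ∈ Set.Icc b a) : X.meanHitTime x S ≠ ⊤ := by
  obtain ⟨g, hg, hgS⟩ := X.exists_dirichlet hS (fun _ => 1) (fun _ => 0)
  have hg0 : ∀ x ∈ Set.Icc b a, 0 ≤ g x :=
    X.le_of_subharmonic_sub hS (f := fun _ => 0)
      (fun x hx hxS => by rw [hg x hx hxS, avg_const]; norm_num) (fun x hx hxS => (hgS x hx hxS).ge)
  exact ((X.meanHitTime_le hg0 (fun x hx hxS => (hg x hx hxS).ge) hx).trans_lt
    ENNReal.ofReal_lt_top).ne

/-- The mean hitting time as a real number. -/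
noncomputable def meanHit (S : Set ℤ) (x : ℤ) : ℝ := (X.meanHitTime x S).toReal

lemma meanHit_nonneg (S : Set ℤ) (x : ℤ) : 0 ≤ X.meanHit S x := ENNReal.toReal_nonneg

lemma ofReal_meanHit {S : Set ℤ} (hS : (S ∩ Set.Icc b a).Nonempty) {x : ℤ}
    (hx : x ∈ Set.Icc b a) : ENNReal.ofReal (X.meanHit S x) = X.meanHitTime x S :=
  ENNReal.ofReal_toReal (X.meanHitTime_ne_top hS hx)

lemma meanHit_of_mem {S : Set ℤ} {x : ℤ} (hx : x ∈ S) : X.meanHit S x = 0 := by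
  simp [meanHit, X.meanHitTime_of_mem hx]

lemma meanHit_sub_avg {S : Set ℤ} (hS : (S ∩ Set.Icc b a).Nonempty) {x : ℤ}
    (hx : x ∈ Set.Icc b a) (hxS : x ∉ S) : X.meanHit S x - X.avg (X.meanHit S) x = 1 := by
  have hf : ∀ y ∈ Set.Icc b a, X.meanHitTime y S ≠ ⊤ := fun y hy => X.meanHitTime_ne_top hS hy
  have h := X.meanHitTime_of_notMem hxS
  have hne : X.avg (fun y => X.meanHitTime y S) x ≠ ⊤ := by
    intro h'; rw [h', top_add] at h; exact hf x hx h
  have h2 := congrArg ENNReal.toReal h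
  rw [ENNReal.toReal_add hne ENNReal.one_ne_top, toReal_avg X hf hx] at h2
  change X.meanHit S x = X.avg (X.meanHit S) x + _ at h2
  rw [h2]; simp

lemma one_le_meanHit {S : Set ℤ} (hS : (S ∩ Set.Icc b a).Nonempty) {x : ℤ}
    (hx : x ∈ Set.Icc b a) (hxS : x ∉ S) : 1 ≤ X.meanHit S x := by
  have := X.meanHit_sub_avg hS hx hxS
  have h : 0 ≤ X.avg (X.meanHit S) x :=
    X.avg_nonneg (X.meanHit_nonneg S) x
  linarith

end BirthDeathChain

/-! ### The last visit under `prepend` -/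

lemma hitTime_eq_coe_iff {S : Set ℤ} {ω : ℕ → ℤ} {n : ℕ} :
    hitTime S ω = n ↔ ω n ∈ S ∧ ∀ m < n, ω m ∉ S := by
  constructor
  · intro h
    have h1 := le_hitTime_iff.1 h.ge
    refine ⟨?_, h1⟩
    have h2 : hitTime S ω < (n + 1 : ℕ) := by rw [h]; exact_mod_cast Nat.lt_succ_self n
    obtain ⟨m, hm, hmS⟩ := hitTime_lt_iff.1 h2
    rcases Nat.lt_succ_iff_lt_or_eq.1 hm with h' | rfl
    · exact absurd hmS (h1 m h')
    · exact hmS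
  · rintro ⟨h1, h2⟩
    exact le_antisymm (iInf₂_le n h1) (le_hitTime_iff.2 h2)

lemma exists_of_hitTime_lt {S : Set ℤ} {ω : ℕ → ℤ} {c : ℕ∞} (h : hitTime S ω < c) :
    ∃ m : ℕ, (m : ℕ∞) < c ∧ ω m ∈ S := by
  obtain ⟨m, hm⟩ := ENat.ne_top_iff_exists.1 (ne_top_of_lt h)
  exact ⟨m, hm ▸ h, (hitTime_eq_coe_iff.1 hm.symm).1⟩

/-- The hypothesis guarantees a visit to `x`. If the only one is at time `0`, it is not counted for
`ω` and the value is the default `0`; after the shift it counts at time `1`, so the formula still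
holds. -/
lemma lastVisitBefore_prepend_of_lt {x y z : ℤ} (hz : z ≠ y) {ω : ℕ → ℤ}
    (h : hitTime {x} ω < hitTime {y} ω) :
    lastVisitBefore x y (prepend z ω) = lastVisitBefore x y ω + 1 := by
  have hstep : ∀ t : ℕ, (t : ℕ∞) < hitTime {y} ω → ω t = x →
      (t : ℕ∞) + 1 ≤ lastVisitBefore x y (prepend z ω) := by
    intro t ht hx
    have : ((t + 1 : ℕ) : ℕ∞) ≤ lastVisitBefore x y (prepend z ω) := by
      refine le_iSup₂_of_le (t + 1) ⟨Nat.succ_pos t, ?_, hx⟩ le_rfl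
      rw [hitTime_prepend_of_notMem (by simpa using hz), Nat.cast_succ]
      exact (ENat.add_lt_add_iff_right ENat.one_ne_top).2 ht
    simpa using this
  apply le_antisymm
  · refine iSup₂_le fun t ht => ?_
    obtain ⟨h0, h1, h2⟩ := ht
    obtain ⟨s, rfl⟩ := Nat.exists_eq_succ_of_ne_zero h0.ne'
    rw [hitTime_prepend_of_notMem (by simpa using hz), Nat.cast_succ,
      ENat.add_lt_add_iff_right ENat.one_ne_top] at h1
    rw [Nat.cast_succ]
    gcongr
    rcases Nat.eq_zero_or_pos s with rfl | hs
    · simp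
    · exact le_iSup₂_of_le s ⟨hs, h1, h2⟩ le_rfl
  · obtain ⟨m, hm, hmx⟩ := exists_of_hitTime_lt h
    have h1 : 1 ≤ lastVisitBefore x y (prepend z ω) := le_add_self.trans (hstep m hm hmx)
    calc lastVisitBefore x y ω + 1 ≤ (lastVisitBefore x y (prepend z ω) - 1) + 1 := by
          gcongr
          refine iSup₂_le fun t ht => ?_
          exact ENat.le_sub_of_add_le_right ENat.one_ne_top (hstep t ht.2.1 ht.2.2)
      _ = _ := tsub_add_cancel_of_le h1

lemma lastVisitBefore_prepend_of_le {x y z : ℤ} (hz : z ≠ y) {ω : ℕ → ℤ}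
    (h : hitTime {y} ω ≤ hitTime {x} ω) : lastVisitBefore x y (prepend z ω) = 0 := by
  refine le_antisymm (iSup₂_le fun t ht => ?_) zero_le
  obtain ⟨h0, h1, h2⟩ := ht
  obtain ⟨s, rfl⟩ := Nat.exists_eq_succ_of_ne_zero h0.ne'
  rw [hitTime_prepend_of_notMem (by simpa using hz), Nat.cast_succ,
    ENat.add_lt_add_iff_right ENat.one_ne_top] at h1
  exact absurd (h1.trans_le h) (not_lt.2 (iInf₂_le s h2))

lemma timeAfterLastVisit_prepend_of_lt {x y z : ℤ} (hz : z ≠ y) {ω : ℕ → ℤ}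
    (h : hitTime {x} ω < hitTime {y} ω) :
    timeAfterLastVisit x y (prepend z ω) = timeAfterLastVisit x y ω := by
  rw [timeAfterLastVisit, lastVisitBefore_prepend_of_lt hz h,
    hitTime_prepend_of_notMem (by simpa using hz), timeAfterLastVisit]
  generalize hitTime {y} ω = u
  generalize lastVisitBefore x y ω = v
  induction u <;> induction v <;> first | rfl | (norm_cast; omega)

lemma timeAfterLastVisit_prepend_of_le {x y z : ℤ} (hz : z ≠ y) {ω : ℕ → ℤ}
    (h : hitTime {y} ω ≤ hitTime {x} ω) :
    timeAfterLastVisit x y (prepend z ω) = hitTime {y} ω + 1 := by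
  rw [timeAfterLastVisit, lastVisitBefore_prepend_of_le hz h,
    hitTime_prepend_of_notMem (by simpa using hz), tsub_zero]

lemma hitTime_ne_of_ne {x y : ℤ} (hxy : x ≠ y) {ω : ℕ → ℤ} {n : ℕ} (h : hitTime {y} ω = n) :
    hitTime {x} ω ≠ n := fun h' =>
  hxy ((hitTime_eq_coe_iff.1 h').1.symm.trans (hitTime_eq_coe_iff.1 h).1)

/-! ### Reversibility and the law of the time after the last visit -/

namespace BirthDeathChain

variable {b a : ℤ} (X : BirthDeathChain b a)

/-- Detailed balance forces the ratios of consecutive weights inside the interval, hence a product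
of `p / q`. Elsewhere both sides of the balance vanish, so it holds for all integers. -/
lemma exists_reversible : ∃ m : ℤ → ℝ, (∀ x, 0 ≤ m x) ∧ (∀ x ∈ Set.Icc b a, 0 < m x) ∧
    ∀ x, m x * X.p x = m (x + 1) * X.q (x + 1) := by
  refine ⟨fun x => ∏ i ∈ Finset.range (x - b).toNat, (X.p (b + i) : ℝ) / X.q (b + i + 1),
    fun x => by positivity, fun x hx => ?_, fun x => ?_⟩
  · refine Finset.prod_pos fun i hi => ?_
    have hi' : (i : ℤ) < x - b := by
      have := Finset.mem_range.1 hi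
      omega
    have h1 : 0 < X.p (b + i) := (X.p_pos_iff _).2 ⟨by omega, by linarith [hx.2]⟩
    have h2 : 0 < X.q (b + i + 1) := (X.q_pos_iff _).2 ⟨by omega, by linarith [hx.2]⟩
    positivity
  · dsimp only
    by_cases hx : b ≤ x ∧ x < a
    · have h : (x + 1 - b).toNat = (x - b).toNat + 1 := by omega
      have h2 : b + ((x - b).toNat : ℤ) = x := by omega
      have h3 : (X.q (x + 1) : ℝ) ≠ 0 :=
        NNReal.coe_ne_zero.2 ((X.q_pos_iff _).2 ⟨by omega, by omega⟩).ne'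
      rw [h, Finset.prod_range_succ, h2]
      field_simp
    · have h1 : X.p x = 0 := by
        by_contra h
        exact hx ((X.p_pos_iff x).1 (pos_iff_ne_zero.2 h))
      have h2 : X.q (x + 1) = 0 := by
        by_contra h
        have := (X.q_pos_iff _).1 (pos_iff_ne_zero.2 h)
        exact hx ⟨by omega, by omega⟩
      simp [h1, h2]

/-- Detailed balance makes the transition operator symmetric. -/
theorem sum_smul_avg {E : Type*} [AddCommGroup E] [Module ℝ E] {m : ℤ → ℝ}
    (hm : ∀ x, m x * X.p x = m (x + 1) * X.q (x + 1)) (g : ℤ → ℝ) (f : ℤ → E) :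
    ∑ x ∈ Finset.Icc b a, (m x * g x) • X.avg f x =
      ∑ x ∈ Finset.Icc b a, (m x * X.avg g x) • f x := by
  -- Shifting the summation index costs only the terms at `b` and `a + 1`, which vanish because the
  -- chain does not leave the interval.
  have key : ∀ F : ℤ → E, F b = 0 → F (a + 1) = 0 →
      ∑ x ∈ Finset.Icc b a, F (x + 1) = ∑ x ∈ Finset.Icc b a, F x := by
    intro F hb ha
    rcases lt_or_ge a b with hab | hab
    · simp [Finset.Icc_eq_empty (not_le.2 hab)]
    have h1 : ∑ x ∈ Finset.Icc b a, F (x + 1) = ∑ x ∈ Finset.Icc (b + 1) (a + 1), F x := by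
      rw [← Finset.map_add_right_Icc, Finset.sum_map]
      simp
    have h2 : ∑ x ∈ Finset.Icc b (a + 1), F x = ∑ x ∈ Finset.Icc b a, F x := by
      refine (Finset.sum_subset (Finset.Icc_subset_Icc_right (by omega)) fun x hx hx' => ?_).symm
      have : x = a + 1 := by simp only [Finset.mem_Icc] at hx hx'; omega
      rw [this, ha]
    have h3 : ∑ x ∈ Finset.Icc (b + 1) (a + 1), F x = ∑ x ∈ Finset.Icc b (a + 1), F x := by
      refine (Finset.sum_subset (Finset.Icc_subset_Icc_left (by omega)) fun x hx hx' => ?_)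
      have : x = b := by simp only [Finset.mem_Icc] at hx hx'; omega
      rw [this, hb]
    rw [h1, h3, h2]
  have hup := key (fun x => (m x * X.q x * g (x - 1)) • f x)
    (by simp [X.q_eq_zero_of_le le_rfl])
    (by rw [← hm, X.p_eq_zero_of_le le_rfl]; simp)
  have hdown := key (fun x => (m x * X.q x * g x) • f (x - 1))
    (by simp [X.q_eq_zero_of_le le_rfl])
    (by rw [← hm, X.p_eq_zero_of_le le_rfl]; simp)
  simp only [← hm, add_sub_cancel_right] at hup hdown
  have hl : ∀ x, (m x * g x) • X.avg f x = (m x * X.p x * g x) • f (x + 1) +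
      (m x * X.q x * g x) • f (x - 1) + (m x * X.r x * g x) • f x := by
    intro x
    rw [mul_right_comm (m x), mul_right_comm (m x) (X.q x : ℝ), mul_right_comm (m x) (X.r x : ℝ)]
    simp only [avg, smul_add, NNReal.smul_def, smul_smul]
  have hr : ∀ x, (m x * X.avg g x) • f x = (m x * X.p x * g (x + 1)) • f x +
      (m x * X.q x * g (x - 1)) • f x + (m x * X.r x * g x) • f x := by
    intro x
    rw [avg_real, ← add_smul, ← add_smul]
    congr 1
    ring
  simp only [hl, hr, Finset.sum_add_distrib]
  rw [hup, ← hdown]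
  abel

lemma sum_sub_avg {m : ℤ → ℝ} (hm : ∀ x, m x * X.p x = m (x + 1) * X.q (x + 1)) (f : ℤ → ℝ) :
    ∑ x ∈ Finset.Icc b a, m x * (f x - X.avg f x) = 0 := by
  have := X.sum_smul_avg hm (fun _ => 1) f
  simp only [avg_const, smul_eq_mul, mul_one] at this
  simp only [mul_sub, Finset.sum_sub_distrib, this, sub_self]

/-- One step of the chain, killed on `S`. -/
noncomputable def killedStep (S : Set ℤ) (f : ℤ → ℝ) (x : ℤ) : ℝ :=
  open Classical in if x ∈ S then 0 else X.avg f x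

/-- Time reversal of paths that avoid `S` at their `n` intermediate times: killing is a
multiplication operator, so the killed steps can be moved across the pairing one by one. -/
lemma sum_mul_avg_iterate_killedStep {m : ℤ → ℝ}
    (hm : ∀ x, m x * X.p x = m (x + 1) * X.q (x + 1)) (S : Set ℤ) (n : ℕ) (f g : ℤ → ℝ) :
    ∑ x ∈ Finset.Icc b a, m x * f x * X.avg ((X.killedStep S)^[n] g) x =
      ∑ x ∈ Finset.Icc b a, m x * g x * X.avg ((X.killedStep S)^[n] f) x := by
  induction n generalizing g with
  | zero =>
    have := X.sum_smul_avg hm f g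
    simp only [smul_eq_mul] at this
    simp only [Function.iterate_zero, id_eq]
    rw [this]
    exact Finset.sum_congr rfl fun x _ => by ring
  | succ n ih =>
    rw [Function.iterate_succ_apply, ih, Function.iterate_succ_apply']
    have := X.sum_smul_avg hm (X.killedStep S ((X.killedStep S)^[n] f)) g
    simp only [smul_eq_mul] at this
    calc _ = ∑ x ∈ Finset.Icc b a, m x * X.killedStep S ((X.killedStep S)^[n] f) x * X.avg g x := by
          refine Finset.sum_congr rfl fun x _ => ?_
          unfold killedStep
          split_ifs <;> ring
      _ = _ := by
          rw [this]
          exact Finset.sum_congr rfl fun x _ => by ring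

/-- Probability to reach `y` at time `n` without visiting `x`. -/
lemma real_pathLaw_hitTime_eq {x y : ℤ} (hxy : x ≠ y) (n : ℕ) (z : ℤ) :
    (X.pathLaw z).real {ω | hitTime {y} ω = n ∧ hitTime {y} ω < hitTime {x} ω} =
      (X.killedStep {x, y})^[n] (fun u => if u = y then 1 else 0) z := by
  have hmeas : ∀ n : ℕ, MeasurableSet {ω | hitTime {y} ω = n ∧ hitTime {y} ω < hitTime {x} ω} :=
    fun n => (measurable_hitTime {y} (measurableSet_singleton (n : ℕ∞))).inter
      (by
        have := borelSpace_enat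
        exact measurableSet_lt (measurable_hitTime _) (measurable_hitTime _))
  induction n generalizing z with
  | zero =>
    rw [real_pathLaw_apply X z (hmeas 0)]
    simp only [Function.iterate_zero, id_eq]
    split_ifs with hz
    · subst hz
      have : prepend z ⁻¹' {ω | hitTime {z} ω = (0 : ℕ) ∧ hitTime {z} ω < hitTime {x} ω} =
          Set.univ := by
        ext ω
        simp only [Set.mem_preimage, Set.mem_ofPred_eq, Set.mem_univ, iff_true]
        rw [hitTime_prepend_of_mem (Set.mem_singleton z),
          hitTime_prepend_of_notMem (by simpa using hxy.symm)]
        simp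
      rw [this]
      simp [avg_const]
    · have : prepend z ⁻¹' {ω | hitTime {y} ω = (0 : ℕ) ∧ hitTime {y} ω < hitTime {x} ω} = ∅ := by
        ext ω
        simp only [Set.mem_preimage, Set.mem_ofPred_eq, Set.mem_empty_iff_false, iff_false]
        rw [hitTime_prepend_of_notMem (by simpa using hz)]
        simp
      rw [this]
      simp [avg_const]
  | succ n ih =>
    rw [real_pathLaw_apply X z (hmeas (n + 1)), Function.iterate_succ_apply', killedStep]
    split_ifs with hz
    · have : prepend z ⁻¹' {ω | hitTime {y} ω = (n + 1 : ℕ) ∧ hitTime {y} ω < hitTime {x} ω} =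
          ∅ := by
        ext ω
        simp only [Set.mem_preimage, Set.mem_ofPred_eq, Set.mem_empty_iff_false, iff_false]
        rcases hz with rfl | rfl
        · rw [hitTime_prepend_of_mem (S := {z}) rfl]; simp
        · rw [hitTime_prepend_of_mem (S := {z}) rfl]
          exact fun h => absurd h.1 (by norm_cast)
      rw [this]
      simp [avg_const]
    · simp only [Set.mem_insert_iff, Set.mem_singleton_iff, not_or] at hz
      congr 1
      ext u
      rw [← ih]
      congr 1
      ext ω
      simp only [Set.mem_preimage, Set.mem_ofPred_eq]
      rw [hitTime_prepend_of_notMem (by simpa using hz.2),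
        hitTime_prepend_of_notMem (by simpa using hz.1),
        ENat.add_lt_add_iff_right ENat.one_ne_top, Nat.cast_succ]
      simp

/-- The law of the time after the last visit, in terms of the paths that avoid returns. -/
lemma real_pathLaw_timeAfterLastVisit_mul {x y : ℤ} (hxy : x ≠ y) (hx : x ∈ Set.Icc b a)
    (hy : y ∈ Set.Icc b a) {k : ℤ → ℝ}
    (hk : ∀ z ∈ Set.Icc b a, z ∉ ({x, y} : Set ℤ) → k z - X.avg k z = 0) (hkx : k x = 1)
    (hky : k y = 0) (n : ℕ) :
    (X.pathLaw x).real {ω | timeAfterLastVisit x y ω = n} * (1 - X.avg k x) =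
      if n = 0 then 0 else
        X.avg ((X.killedStep {x, y})^[n - 1] (fun u => if u = y then 1 else 0)) x := by
  set G : Set (ℕ → ℤ) :=
    {ω | timeAfterLastVisit x y ω = n} ∩ {ω | hitTime {x} ω < hitTime {y} ω} with hG
  have hT : MeasurableSet {ω | timeAfterLastVisit x y ω = n} :=
    measurable_timeAfterLastVisit x y (measurableSet_singleton (n : ℕ∞))
  have hlt : MeasurableSet {ω | hitTime {x} ω < hitTime {y} ω} := by
    have := borelSpace_enat
    exact measurableSet_lt (measurable_hitTime _) (measurable_hitTime _)
  have hGm : MeasurableSet G := hT.inter hlt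
  set g : ℤ → ℝ := fun z => (X.pathLaw z).real G with hg
  have hgoff : ∀ z, z ∉ ({x, y} : Set ℤ) → g z = X.avg g z := by
    intro z hz
    simp only [Set.mem_insert_iff, Set.mem_singleton_iff, not_or] at hz
    simp only [hg]
    rw [real_pathLaw_apply X z hGm]
    congr 1
    ext u
    congr 1
    ext ω
    simp only [hG, Set.mem_preimage, Set.mem_inter_iff, Set.mem_ofPred_eq]
    rw [hitTime_prepend_of_notMem (S := {y}) (by simpa using hz.2),
        hitTime_prepend_of_notMem (S := {x}) (by simpa using hz.1),
        ENat.add_lt_add_iff_right ENat.one_ne_top]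
    exact and_congr_left fun h => by rw [timeAfterLastVisit_prepend_of_lt hz.2 h]
  have hgy : g y = 0 := by
    simp only [hg]
    rw [real_pathLaw_apply X y hGm]
    have : prepend y ⁻¹' G = ∅ := by
      ext ω
      simp only [hG, Set.mem_preimage, Set.mem_inter_iff, Set.mem_ofPred_eq]
      rw [hitTime_prepend_of_mem (S := {y}) rfl]
      simp
    simp [this, avg_const]
  -- Started at `x ≠ y`, the chain hits `x` at time `0`, so the extra event is certain.
  have hgx : (X.pathLaw x).real {ω | timeAfterLastVisit x y ω = n} = g x := by
    simp only [hg]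
    rw [real_pathLaw_apply X x hGm, real_pathLaw_apply X x hT]
    congr 1
    ext u
    congr 1
    ext ω
    simp only [hG, Set.mem_preimage, Set.mem_inter_iff, Set.mem_ofPred_eq]
    rw [hitTime_prepend_of_notMem (S := {y}) (by simpa using hxy),
        hitTime_prepend_of_mem (S := {x}) rfl]
    simp
  -- Both sides solve the same Dirichlet problem off `{x, y}`.
  have hgk : ∀ z ∈ Set.Icc b a, g z = g x * k z := by
    have hS : (({x, y} : Set ℤ) ∩ Set.Icc b a).Nonempty := ⟨x, by simp, hx⟩
    have hd : ∀ z ∈ Set.Icc b a, z ∉ ({x, y} : Set ℤ) →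
        g z - X.avg g z = g x * k z - X.avg (fun z => g x * k z) z := by
      intro z hz hzS
      rw [avg_const_mul, ← mul_sub, hk z hz hzS, ← hgoff z hzS]; ring
    have hb : ∀ z ∈ Set.Icc b a, z ∈ ({x, y} : Set ℤ) → g z = g x * k z := by
      rintro z - (rfl | rfl)
      · rw [hkx, mul_one]
      · rw [hgy, hky, mul_zero]
    intro z hz
    apply le_antisymm
    · exact X.le_of_subharmonic_sub hS (fun z hz hzS => (hd z hz hzS).le)
        (fun z hz hzS => (hb z hz hzS).le) z hz
    · exact X.le_of_subharmonic_sub hS (fun z hz hzS => (hd z hz hzS).ge)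
        (fun z hz hzS => (hb z hz hzS).ge) z hz
  have hstep : g x = X.avg g x + if n = 0 then 0 else
      X.avg ((X.killedStep {x, y})^[n - 1] (fun u => if u = y then 1 else 0)) x := by
    have h1 : prepend x ⁻¹' G = G ∪ {ω | hitTime {y} ω + 1 = n ∧
        hitTime {y} ω < hitTime {x} ω} := by
      ext ω
      simp only [hG, Set.mem_preimage, Set.mem_inter_iff, Set.mem_ofPred_eq, Set.mem_union]
      rw [hitTime_prepend_of_notMem (S := {y}) (by simpa using hxy),
        hitTime_prepend_of_mem (S := {x}) rfl]
      rcases lt_or_ge (hitTime {x} ω) (hitTime {y} ω) with h | h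
      · rw [timeAfterLastVisit_prepend_of_lt hxy h]
        simp [h, h.not_gt]
      · rw [timeAfterLastVisit_prepend_of_le hxy h]
        simp only [add_pos_iff, zero_lt_one, or_true, and_true, h.not_gt, and_false, false_or]
        -- Two distinct states can only be hit simultaneously at `⊤`, which the finite total `n`
        -- excludes.
        refine ⟨fun h1 => ⟨h1, lt_of_le_of_ne h fun h2 => ?_⟩, fun h1 => h1.1⟩
        have h3 : hitTime {y} ω ≠ ⊤ := by
          intro h4; rw [h4, top_add] at h1; exact ENat.top_ne_natCast n h1
        obtain ⟨l, hl⟩ := ENat.ne_top_iff_exists.1 h3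
        exact hitTime_ne_of_ne hxy hl.symm (h2.symm.trans hl.symm)
    have hdis : Disjoint G {ω | hitTime {y} ω + 1 = n ∧ hitTime {y} ω < hitTime {x} ω} := by
      rw [Set.disjoint_left]
      rintro ω ⟨-, h1⟩ ⟨-, h2⟩
      exact lt_asymm h1 h2
    have hm2 : MeasurableSet {ω | hitTime {y} ω + 1 = n ∧ hitTime {y} ω < hitTime {x} ω} := by
      have := borelSpace_enat
      refine MeasurableSet.inter (s₁ := {ω | hitTime {y} ω + 1 = n})
        (s₂ := {ω | hitTime {y} ω < hitTime {x} ω}) ?_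
        (measurableSet_lt (measurable_hitTime _) (measurable_hitTime _))
      exact measurable_hitTime {y} (MeasurableSet.of_discrete (s := {t : ℕ∞ | t + 1 = n}))
    have h2 : g x = X.avg (fun u => g u + (X.pathLaw u).real
        {ω | hitTime {y} ω + 1 = n ∧ hitTime {y} ω < hitTime {x} ω}) x := by
      simp only [hg]
      rw [real_pathLaw_apply X x hGm]
      congr 1
      ext u
      rw [h1, measureReal_union hdis hm2]
    rw [avg_add] at h2
    rw [h2]
    congr 1
    split_ifs with hn
    · subst hn
      simp [avg_const]
    · obtain ⟨l, rfl⟩ := Nat.exists_eq_succ_of_ne_zero hn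
      congr 1
      ext u
      rw [Nat.succ_eq_add_one, Nat.add_sub_cancel, ← real_pathLaw_hitTime_eq X hxy]
      congr 1
      ext ω
      simp only [Set.mem_ofPred_eq, Nat.cast_succ]
      simp
  have havg : X.avg g x = g x * X.avg k x := by
    rw [← avg_const_mul]; exact X.avg_congr hgk hx
  rw [hgx, mul_sub, mul_one, ← havg]
  linarith [hstep]

end BirthDeathChain

lemma ENat.measure_ext {μ ν : Measure ℕ∞} [IsProbabilityMeasure μ] [IsProbabilityMeasure ν]
    (h : ∀ n : ℕ, μ {(n : ℕ∞)} = ν {(n : ℕ∞)}) : μ = ν := by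
  refine Measure.ext_of_singleton fun t => ?_
  induction t with
  | coe n => exact h n
  | top =>
    have h1 : ({⊤} : Set ℕ∞) = (⋃ n : ℕ, {(n : ℕ∞)})ᶜ := by
      ext t
      induction t <;> simp
    have hd : Pairwise (Function.onFun Disjoint fun n : ℕ => ({(n : ℕ∞)} : Set ℕ∞)) := by
      intro i j hij
      simpa [Function.onFun] using hij
    rw [h1, prob_compl_eq_one_sub .of_discrete, prob_compl_eq_one_sub .of_discrete,
      measure_iUnion hd fun _ => .of_discrete, measure_iUnion hd fun _ => .of_discrete]
    simp only [h]

namespace BirthDeathChain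

variable {b a : ℤ} (X : BirthDeathChain b a)

/-- The time after the last visit has the same law in both directions. -/
theorem identDistrib_timeAfterLastVisit {x y : ℤ} (hx : x ∈ Set.Icc b a)
    (hy : y ∈ Set.Icc b a) :
    IdentDistrib (timeAfterLastVisit x y) (timeAfterLastVisit y x) (X.pathLaw x) (X.pathLaw y) := by
  rcases eq_or_ne x y with rfl | hxy
  · exact .refl (measurable_timeAfterLastVisit _ _).aemeasurable
  refine ⟨(measurable_timeAfterLastVisit _ _).aemeasurable,
    (measurable_timeAfterLastVisit _ _).aemeasurable, ?_⟩
  have := Measure.isProbabilityMeasure_map (μ := X.pathLaw x)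
    (measurable_timeAfterLastVisit x y).aemeasurable
  have := Measure.isProbabilityMeasure_map (μ := X.pathLaw y)
    (measurable_timeAfterLastVisit y x).aemeasurable
  refine ENat.measure_ext fun n => ?_
  rw [Measure.map_apply (measurable_timeAfterLastVisit _ _) (measurableSet_singleton _),
    Measure.map_apply (measurable_timeAfterLastVisit _ _) (measurableSet_singleton _),
    ← ENNReal.toReal_eq_toReal_iff' (measure_ne_top _ _) (measure_ne_top _ _)]
  change (X.pathLaw x).real {ω | timeAfterLastVisit x y ω = n} =
    (X.pathLaw y).real {ω | timeAfterLastVisit y x ω = n}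
  obtain ⟨k, hk, hkS⟩ := X.exists_dirichlet (S := {x, y}) ⟨x, by simp, hx⟩ (fun _ => 0)
    (fun z => if z = x then 1 else 0)
  have hkx : k x = 1 := by simpa using hkS x hx (by simp)
  have hky : k y = 0 := by simpa [hxy.symm] using hkS y hy (by simp)
  obtain ⟨m, -, hmpos, hm⟩ := X.exists_reversible
  have h1 := X.real_pathLaw_timeAfterLastVisit_mul hxy hx hy hk hkx hky n
  -- For the reversed pair the harmonic function is the complement `1 - k`.
  have h2 := X.real_pathLaw_timeAfterLastVisit_mul hxy.symm hy hx (k := fun z => 1 - k z)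
    (fun z hz hzS => by
      rw [avg_sub, avg_const]
      linarith [hk z hz (by rwa [Set.pair_comm])]) (by simp [hky]) (by simp [hkx]) n
  rw [avg_sub, avg_const, sub_sub_cancel] at h2
  -- The defect `k - avg k` lives on `{x, y}` and has total `m`-mass zero.
  have hbal : m x * (1 - X.avg k x) = m y * X.avg k y := by
    have h := X.sum_sub_avg hm k
    rw [Finset.sum_eq_add x y hxy, hkx, hky] at h
    · linarith
    · rintro z hz ⟨h1, h2⟩
      rw [hk z (by simpa using hz) (by simp [h1, h2]), mul_zero]
    · exact fun h => absurd (by simpa using hx) h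
    · exact fun h => absurd (by simpa using hy) h
  have hpos : 0 < 1 - X.avg k x := by
    -- Otherwise `k` would be subharmonic at `x` too, and the maximum principle off `{y}` would give
    -- `k x ≤ 0`.
    by_contra! hle
    have := X.le_zero_of_subharmonic (S := {y}) ⟨y, rfl, hy⟩ (w := k) (fun z hz hzy => ?_)
      (fun z hz hzy => by rw [hzy, hky]) x hx
    · linarith
    · by_cases hzx : z = x
      · rw [hzx, hkx]; linarith
      · linarith [hk z hz (by rintro (h | h); exacts [hzx h, hzy h])]
  have hsym : m x *
      X.avg ((X.killedStep {x, y})^[n - 1] (fun u => if u = y then 1 else 0)) x =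
      m y * X.avg ((X.killedStep {y, x})^[n - 1] (fun u => if u = x then 1 else 0)) y := by
    have h := X.sum_mul_avg_iterate_killedStep hm {x, y} (n - 1) (fun u => if u = x then 1 else 0)
      (fun u => if u = y then 1 else 0)
    simp only [mul_ite, mul_one, mul_zero, ite_mul, zero_mul, Finset.sum_ite_eq',
      Finset.mem_Icc.2 hx, Finset.mem_Icc.2 hy, if_true] at h
    rw [h, Set.pair_comm]
  have hmx := hmpos x hx
  have hmy := hmpos y hy
  refine mul_right_cancel₀ (mul_pos hmx hpos).ne' ?_
  calc _ = m x * ((X.pathLaw x).real {ω | timeAfterLastVisit x y ω = n} * (1 - X.avg k x)) := by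
        ring
    _ = m y * ((X.pathLaw y).real {ω | timeAfterLastVisit y x ω = n} * X.avg k y) := by
        rw [h1, h2]
        split_ifs with hn
        · simp
        · exact hsym
    _ = _ := by rw [hbal]; ring

end BirthDeathChain

/-! ### Strong drift: second moments and comparison of mean times -/

namespace BirthDeathChain

variable {b a : ℤ} (X : BirthDeathChain b a)

/-- Off `{y, z}` both sides have defect one, so the comparison principle replaces the strong Markov
property. -/
lemma meanHit_triangle {x y z : ℤ} (hx : x ∈ Set.Icc b a) (hy : y ∈ Set.Icc b a)
    (hz : z ∈ Set.Icc b a) : X.meanHit {z} x ≤ X.meanHit {y} x + X.meanHit {z} y := by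
  refine X.le_of_subharmonic_sub (S := {y, z}) ⟨y, by simp, hy⟩
    (g := fun x => X.meanHit {y} x + X.meanHit {z} y) (fun w hw hwS => ?_) (fun w hw hwS => ?_) x hx
  · simp only [Set.mem_insert_iff, Set.mem_singleton_iff, not_or] at hwS
    rw [avg_add, avg_const, X.meanHit_sub_avg ⟨z, Set.mem_singleton z, hz⟩ hw hwS.2]
    linarith [X.meanHit_sub_avg ⟨y, Set.mem_singleton y, hy⟩ hw hwS.1]
  · rcases hwS with rfl | rfl
    · linarith [X.meanHit_nonneg {w} w]
    · rw [X.meanHit_of_mem (Set.mem_singleton w)]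
      linarith [X.meanHit_nonneg {y} w, X.meanHit_nonneg {w} y]

lemma avg_congr_of_adjacent {f g : ℤ → ℝ} {x : ℤ} (h1 : f (x - 1) = g (x - 1)) (h2 : f x = g x)
    (h3 : f (x + 1) = g (x + 1)) : X.avg f x = X.avg g x := by
  rw [avg_real, avg_real, h1, h2, h3]

/-- The equation for the mean, rewritten as a first-order recursion for its increments. It starts at
`a`, where `p` vanishes. -/
lemma meanHit_zero_balance (hb : b ≤ 0) {x : ℤ} (hx : 1 ≤ x) (hxa : x ≤ a) :
    X.q x * (X.meanHit {0} x - X.meanHit {0} (x - 1)) =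
      1 + X.p x * (X.meanHit {0} (x + 1) - X.meanHit {0} x) := by
  have h := X.meanHit_sub_avg (S := {0}) ⟨0, Set.mem_singleton 0, hb, by omega⟩ (x := x)
    ⟨by omega, hxa⟩
    (by simp; omega)
  rw [avg_real, coe_r] at h
  linarith

lemma meanHit_zero_sub_nonneg (hb : b ≤ 0) {x : ℤ} (hxa : x ≤ a) :
    1 ≤ x → 0 ≤ X.meanHit {0} x - X.meanHit {0} (x - 1) := by
  induction x, hxa using Int.leInductionDown with
  | base =>
    intro h
    have hq : (0 : ℝ) < X.q a := by exact_mod_cast (X.q_pos_iff a).2 ⟨by omega, le_rfl⟩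
    have := X.meanHit_zero_balance hb h le_rfl
    rw [X.p_eq_zero_of_le le_rfl] at this
    refine (mul_nonneg_iff_of_pos_left hq).1 ?_
    rw [this]; simp
  | pred n hn ih =>
    intro h
    have hq : (0 : ℝ) < X.q (n - 1) := by
      exact_mod_cast (X.q_pos_iff _).2 ⟨by omega, by omega⟩
    have := X.meanHit_zero_balance hb h (by omega)
    refine (mul_nonneg_iff_of_pos_left hq).1 ?_
    rw [this, sub_add_cancel]
    have := ih (by omega)
    positivity

lemma q_mul_meanHit_zero_sub_le (hb : b ≤ 0) {K : ℝ}
    (hK : ∀ x ∈ Set.Icc 1 a, X.q x * X.meanHit {x - 1} x ≤ K) {x : ℤ} (hx : x ∈ Set.Icc 1 a) :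
    X.q x * (X.meanHit {0} x - X.meanHit {0} (x - 1)) ≤ K := by
  refine le_trans ?_ (hK x hx)
  have := X.meanHit_triangle (x := x) (y := x - 1) (z := 0) ⟨by linarith [hx.1], hx.2⟩
    ⟨by linarith [hx.1], by linarith [hx.2]⟩ ⟨hb, by linarith [hx.1, hx.2]⟩
  gcongr
  linarith

lemma meanHit_zero_sub_le (hb : b ≤ 0) {δ K : ℝ} (hδ : 0 < δ)
    (hq : ∀ x ∈ Set.Icc 1 a, δ ≤ X.q x)
    (hK : ∀ x ∈ Set.Icc 1 a, X.q x * X.meanHit {x - 1} x ≤ K) {x : ℤ} (hx : x ∈ Set.Icc 1 a) :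
    X.meanHit {0} x - X.meanHit {0} (x - 1) ≤ K / δ := by
  rw [le_div_iff₀ hδ, mul_comm]
  refine le_trans ?_ (X.q_mul_meanHit_zero_sub_le hb hK hx)
  have := X.meanHit_zero_sub_nonneg hb hx.2 hx.1
  gcongr
  exact hq x hx

/-- The squared mean hitting time of `0` is nearly superharmonic under strong drift. -/
lemma avg_sq_meanHit_zero_le (hb : b ≤ 0) {δ K : ℝ} (hδ : 0 < δ)
    (hq : ∀ x ∈ Set.Icc 1 a, δ ≤ X.q x)
    (hK : ∀ x ∈ Set.Icc 1 a, X.q x * X.meanHit {x - 1} x ≤ K) {x : ℤ} (hx : x ∈ Set.Icc 1 a) :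
    X.avg (fun y => X.meanHit {0} y ^ 2) x ≤
      X.meanHit {0} x ^ 2 - 2 * X.meanHit {0} x + 2 * K ^ 2 / δ := by
  have hbal := X.meanHit_zero_balance hb hx.1 hx.2
  have h1 := X.q_mul_meanHit_zero_sub_le hb hK hx
  have h2 := X.meanHit_zero_sub_le hb hδ hq hK hx
  have h3 := X.meanHit_zero_sub_nonneg hb hx.2 hx.1
  have hKδ : 0 ≤ K / δ := h3.trans h2
  -- By the balance, `p` times the upper increment is `q` times the lower one minus one, hence at
  -- most `K`; the remaining factor is at most `K / δ`.
  have hup : X.p x * (X.meanHit {0} (x + 1) - X.meanHit {0} x) ^ 2 ≤ K * (K / δ) := by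
    rcases lt_or_ge x a with hxa | hxa
    · have h4 := X.meanHit_zero_sub_le hb hδ hq hK (x := x + 1) ⟨by linarith [hx.1], hxa⟩
      have h5 := X.meanHit_zero_sub_nonneg hb (x := x + 1) hxa (by linarith [hx.1])
      rw [add_sub_cancel_right] at h4 h5
      rw [sq, ← mul_assoc]
      exact mul_le_mul (by linarith) h4 h5 (by
        have : 0 ≤ K / δ * δ := by positivity
        rwa [div_mul_cancel₀ _ hδ.ne'] at this)
    · rw [X.p_eq_zero_of_le hxa]
      have : K * (K / δ) = (K / δ) ^ 2 * δ := by field_simp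
      rw [this, NNReal.coe_zero, zero_mul]
      positivity
  have hdown : X.q x * (X.meanHit {0} x - X.meanHit {0} (x - 1)) ^ 2 ≤ K * (K / δ) := by
    rw [sq, ← mul_assoc]
    exact mul_le_mul h1 h2 h3 ((by positivity : 0 ≤ X.q x *
      (X.meanHit {0} x - X.meanHit {0} (x - 1))).trans h1)
  have h6 : 2 * K ^ 2 / δ = 2 * (K * (K / δ)) := by ring
  rw [avg_real, coe_r, h6]
  generalize X.meanHit {0} x = u at *
  generalize X.meanHit {0} (x + 1) = v at *
  generalize X.meanHit {0} (x - 1) = w at *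
  -- The terms linear in the increments combine to `-2 u` by the balance; the two squares give the
  -- error `2 K² / δ`.
  have : X.p x * v ^ 2 + X.q x * w ^ 2 + (1 - X.p x - X.q x) * u ^ 2 =
      u ^ 2 + X.p x * (v - u) ^ 2 + X.q x * (u - w) ^ 2 +
        2 * u * (X.p x * (v - u) - X.q x * (u - w)) := by ring
  rw [this, hbal]
  linarith

/-- The second moment is dominated by a solution `g` with defect `2 f - 1`, while `f² + C f` has
defect at least `2 f` on the right of `0`. -/
theorem lintegral_sq_hitTime_zero_le (hb : b ≤ 0) {δ K : ℝ} (hδ : 0 < δ)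
    (hq : ∀ x ∈ Set.Icc 1 a, δ ≤ X.q x)
    (hK : ∀ x ∈ Set.Icc 1 a, X.q x * X.meanHit {x - 1} x ≤ K) (ha : 0 < a) :
    ∫⁻ ω, (hitTime {0} ω : ℝ≥0∞) ^ 2 ∂X.pathLaw a ≤
      ENNReal.ofReal (X.meanHit {0} a ^ 2 + 2 * K ^ 2 / δ * X.meanHit {0} a) := by
  have hS : (({0} : Set ℤ) ∩ Set.Icc b a).Nonempty := ⟨0, Set.mem_singleton 0, hb, ha.le⟩
  set f := X.meanHit {0} with hf
  have hf1 : ∀ x ∈ Set.Icc b a, x ∉ ({0} : Set ℤ) → f x - X.avg f x = 1 :=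
    fun x hx hxS => X.meanHit_sub_avg hS hx hxS
  obtain ⟨g, hg, hgS⟩ := X.exists_dirichlet hS (fun x => 2 * f x - 1) (fun _ => 0)
  have hf1' : ∀ x ∈ Set.Icc b a, x ∉ ({0} : Set ℤ) → 1 ≤ f x :=
    fun x hx hxS => X.one_le_meanHit hS hx hxS
  have hg0 : ∀ x ∈ Set.Icc b a, 0 ≤ g x :=
    X.le_of_subharmonic_sub hS (f := fun _ => 0)
      (fun x hx hxS => by
        rw [hg x hx hxS, avg_const]; linarith [hf1' x hx hxS])
      (fun x hx hxS => (hgS x hx hxS).ge)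
  have hmain := X.lintegral_sq_hitTime_le (S := {0}) (g := f) (g₂ := g)
    (fun x _ => X.meanHit_nonneg _ x) (fun x hx hxS => (hf1 x hx hxS).ge) hg0
    (fun x hx hxS => by linarith [hg x hx hxS, hf1 x hx hxS]) (x := a) ⟨by omega, le_rfl⟩
  refine hmain.trans (ENNReal.ofReal_le_ofReal ?_)
  set C := 2 * K ^ 2 / δ with hC
  let w : ℤ → ℝ := fun y => g y - f y ^ 2 - C * f y
  -- Composing with `max · 0` makes the states on the left irrelevant: the drift is only assumed on
  -- the right.
  have hw := X.le_zero_of_subharmonic (S := Set.Iic 0) ⟨0, Set.mem_Iic.2 le_rfl, hb, ha.le⟩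
    (w := fun y => w (max y 0)) (fun x hx hx0 => ?_) (fun x hx hx0 => ?_) a ⟨by omega, le_rfl⟩
  · rw [max_eq_left ha.le] at hw
    simp only [w] at hw
    linarith
  · simp only [Set.mem_Iic, not_le] at hx0
    rw [X.avg_congr_of_adjacent (g := w) (by rw [max_eq_left (by omega)])
      (by rw [max_eq_left (by omega)]) (by rw [max_eq_left (by omega)]), max_eq_left (by omega)]
    simp only [w]
    rw [avg_sub, avg_sub, avg_const_mul]
    have h1 := X.avg_sq_meanHit_zero_le hb hδ hq hK (x := x) ⟨hx0, hx.2⟩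
    have h2 := hg x hx (by simp; omega)
    have h3 := hf1 x hx (by simp; omega)
    rw [← hf, ← hC] at h1
    have h4 : X.avg f x = f x - 1 := by linarith
    rw [h4]
    linarith
  · rw [max_eq_right hx0]
    simp only [w]
    rw [hgS 0 ⟨hb, ha.le⟩ rfl, hf, X.meanHit_of_mem (Set.mem_singleton 0)]
    simp

/-- Under strong drift the mean time against the drift is at least quadratic in the mean time
along it. -/
theorem sq_meanHit_zero_le (hb : b ≤ 0) {δ K : ℝ} (hδ : 0 < δ)
    (hq : ∀ x ∈ Set.Icc 1 a, δ ≤ X.q x)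
    (hK : ∀ x ∈ Set.Icc 1 a, X.q x * X.meanHit {x - 1} x ≤ K) (hδ1 : δ ≤ 1) (ha : 0 < a) :
    δ ^ 2 * X.meanHit {0} a ^ 2 ≤ 2 * K ^ 2 * X.meanHit {a} 0 := by
  set f := X.meanHit {0} with hf
  have hf0 : f 0 = 0 := X.meanHit_of_mem rfl
  -- The left function vanishes at `a`, is constant on the left of `0`, and has defect at most `2
  -- K²`, which is the defect of the right one.
  have h := X.le_of_subharmonic_sub (S := {a}) ⟨a, Set.mem_singleton a, by omega, le_rfl⟩
    (f := fun x => δ ^ 2 * (f a ^ 2 - f (max x 0) ^ 2)) (g := fun x => 2 * K ^ 2 * X.meanHit {a} x)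
    (fun x hx hxa => ?_) (fun x hx hxa => ?_) 0 ⟨hb, ha.le⟩
  · simp only [max_self, hf0] at h
    linarith
  · rw [avg_const_mul, avg_const_mul, ← mul_sub, ← mul_sub, avg_sub, avg_const,
      X.meanHit_sub_avg ⟨a, Set.mem_singleton a, by omega, le_rfl⟩ hx hxa, mul_one,
      sub_sub_sub_cancel_left]
    rcases lt_trichotomy x 0 with hx0 | rfl | hx0
    · rw [X.avg_congr_of_adjacent (g := fun _ => 0) (by rw [max_eq_right (by omega), hf0]; simp)
        (by rw [max_eq_right (by omega), hf0]; simp) (by rw [max_eq_right (by omega), hf0]; simp),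
        avg_const, max_eq_right hx0.le, hf0]
      simp only [ne_eq, OfNat.ofNat_ne_zero, not_false_eq_true, zero_pow, sub_self, mul_zero]
      positivity
    -- At `0` only the step to `1` contributes, and `f 1 ≤ K / δ`.
    · rw [avg_real]
      have h1 := X.meanHit_zero_sub_le hb hδ hq hK (x := 1) ⟨le_rfl, by omega⟩
      have h2 := X.meanHit_nonneg {0} 1
      rw [sub_self, ← hf, hf0, sub_zero] at h1
      rw [← hf] at h2
      norm_num [hf0]
      have hp : (X.p 0 : ℝ) ≤ 1 := by
        exact_mod_cast le_self_add.trans (X.p_add_q_le_one 0)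
      calc δ ^ 2 * (X.p 0 * f 1 ^ 2) ≤ δ ^ 2 * (1 * (K / δ) ^ 2) := by gcongr
        _ = K ^ 2 := by field_simp
        _ ≤ 2 * K ^ 2 := by nlinarith [sq_nonneg K]
    · rw [X.avg_congr_of_adjacent (g := fun y => f y ^ 2) (by rw [max_eq_left (by omega)])
        (by rw [max_eq_left (by omega)]) (by rw [max_eq_left (by omega)]), max_eq_left (by omega)]
      have h1 := X.avg_sq_meanHit_zero_le hb hδ hq hK (x := x) ⟨hx0, hx.2⟩
      have h2 := X.meanHit_nonneg {0} x
      rw [← hf] at h1 h2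
      calc δ ^ 2 * (X.avg (fun y => f y ^ 2) x - f x ^ 2) ≤ δ ^ 2 * (2 * K ^ 2 / δ) := by
            gcongr; linarith
        _ = δ * (2 * K ^ 2) := by field_simp
        _ ≤ 1 * (2 * K ^ 2) := by gcongr
        _ = _ := one_mul _
  · rw [Set.mem_singleton_iff] at hxa
    subst hxa
    rw [max_eq_left ha.le, sub_self, mul_zero]
    exact mul_nonneg (by positivity) (X.meanHit_nonneg {x} x)

/-- A lower bound on the mean exit time from the interval. -/
lemma le_meanHit_pair (hb : b ≤ 0) (ha : 0 ≤ a) {α β : ℝ} (hα : 0 ≤ α) (hβ : 0 ≤ β)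
    (h1 : α * (X.meanHit {0} b + X.meanHit {a} 0) ≤ 1)
    (h2 : β * (X.meanHit {0} a + X.meanHit {b} 0) ≤ 1) :
    α * X.meanHit {a} 0 + β * X.meanHit {b} 0 - 1 ≤ (α + β) * X.meanHit {a, b} 0 := by
  have haI : a ∈ Set.Icc b a := ⟨hb.trans ha, le_rfl⟩
  have hbI : b ∈ Set.Icc b a := ⟨le_rfl, hb.trans ha⟩
  have h0I : (0 : ℤ) ∈ Set.Icc b a := ⟨hb, ha⟩
  -- Both functions have defect `α + β` off `{a, b}`. By the triangle inequality through `0`, the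
  -- assumptions on `α` and `β` make the left one nonpositive at both ends.
  refine X.le_of_subharmonic_sub (S := {a, b}) ⟨a, by simp, haI⟩
    (f := fun x => α * X.meanHit {a} x + β * X.meanHit {b} x - 1)
    (g := fun x => (α + β) * X.meanHit {a, b} x) (fun x hx hxS => ?_) (fun x hx hxS => ?_) 0 h0I
  · have h3 := X.meanHit_sub_avg ⟨a, by simp, haI⟩ hx hxS
    simp only [Set.mem_insert_iff, Set.mem_singleton_iff, not_or] at hxS
    have h4 := X.meanHit_sub_avg (S := {a}) ⟨a, Set.mem_singleton a, haI⟩ hx hxS.1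
    have h5 := X.meanHit_sub_avg (S := {b}) ⟨b, Set.mem_singleton b, hbI⟩ hx hxS.2
    rw [avg_sub, avg_add, avg_const, avg_const_mul, avg_const_mul, avg_const_mul]
    have h6 : X.avg (X.meanHit {a, b}) x = X.meanHit {a, b} x - 1 := by linarith
    have h7 : X.avg (X.meanHit {a}) x = X.meanHit {a} x - 1 := by linarith
    have h8 : X.avg (X.meanHit {b}) x = X.meanHit {b} x - 1 := by linarith
    rw [h6, h7, h8]
    linarith
  · rw [X.meanHit_of_mem hxS]
    rcases hxS with rfl | rfl
    · have := X.meanHit_triangle haI h0I hbI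
      rw [X.meanHit_of_mem (Set.mem_singleton x)]
      nlinarith
    · have := X.meanHit_triangle hbI h0I haI
      rw [X.meanHit_of_mem (Set.mem_singleton x)]
      nlinarith

/-! ### The generating function of the escape time -/

/-- The charge `m (h - avg h)` lives on `0` and `S` and has total mass zero, so a function that is
constant on `S` enters only through `c - F 0`. -/
lemma sum_smul_sub_avg_eq {S : Set ℤ} {m h : ℤ → ℝ} {E : Type*} [AddCommGroup E] [Module ℝ E]
    (hm : ∀ x, m x * X.p x = m (x + 1) * X.q (x + 1)) (h0 : (0 : ℤ) ∈ Set.Icc b a)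
    (hh : ∀ x ∈ Set.Icc b a, x ∉ insert 0 S → h x - X.avg h x = 0)
    {F : ℤ → E} {c : E} (hF : ∀ x ∈ Set.Icc b a, x ∈ S → F x = c) :
    ∑ x ∈ Finset.Icc b a, (m x * (h x - X.avg h x)) • F x =
      (m 0 * (X.avg h 0 - h 0)) • (c - F 0) := by
  have h1 : ∑ x ∈ Finset.Icc b a, (m x * (h x - X.avg h x)) • (F x - c) =
      (m 0 * (h 0 - X.avg h 0)) • (F 0 - c) := by
    refine Finset.sum_eq_single_of_mem 0 (by simpa using h0) fun x hx hx0 => ?_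
    by_cases hxS : x ∈ S
    · rw [hF x (by simpa using hx) hxS, sub_self, smul_zero]
    · rw [hh x (by simpa using hx) (by simp [hx0, hxS]), mul_zero, zero_smul]
  simp only [smul_sub, Finset.sum_sub_distrib, ← Finset.sum_smul, X.sum_sub_avg hm h,
    zero_smul, sub_zero] at h1
  rw [h1, ← neg_sub (h 0), mul_neg, neg_smul, smul_sub]
  abel

/-- If the chain returns to `0` fast compared to the mean time needed to reach `S`, then the
generating function of this time is nearly the one of an exponential variable. -/
theorem norm_one_sub_mul_le {S : Set ℤ} (h0 : (0 : ℤ) ∈ Set.Icc b a)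
    (hS : (S ∩ Set.Icc b a).Nonempty) (h0S : (0 : ℤ) ∉ S) {D : ℝ}
    (hD : ∀ x ∈ Set.Icc b a, X.meanHit {0} x ≤ D) {u : ℤ → ℂ}
    (hu1 : ∀ x, ‖u x‖ ≤ 1) {ζ : ℂ} (hζ : ‖ζ‖ = 1)
    (hu : ∀ x ∈ Set.Icc b a, x ∉ S → u x = ζ * X.avg u x)
    (huS : ∀ x ∈ Set.Icc b a, x ∈ S → u x = 1) :
    ‖1 - u 0 * (1 + (ζ⁻¹ - 1) * X.meanHit S 0)‖ ≤
      ‖ζ - 1‖ * (2 * D + ‖ζ - 1‖ * (D * X.meanHit S 0)) := by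
  obtain ⟨m, hm0, hmpos, hm⟩ := X.exists_reversible
  have hζ0 : ζ ≠ 0 := by rintro rfl; simp at hζ
  have hS' : (insert 0 S ∩ Set.Icc b a).Nonempty := ⟨0, by simp, h0⟩
  -- `h` plays the role of the probability of reaching `S` before `0`.
  obtain ⟨h, hh, hhS⟩ := X.exists_dirichlet hS' (fun _ => 0) (fun x => if x = 0 then 0 else 1)
  have hh0 : h 0 = 0 := by simpa using hhS 0 h0 (by simp)
  have hh1 : ∀ x ∈ Set.Icc b a, x ∈ S → h x = 1 := fun x hx hxS => by
    have : x ≠ 0 := by rintro rfl; exact h0S hxS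
    simpa [this] using hhS x hx (by simp [hxS])
  have hnn : ∀ x ∈ Set.Icc b a, 0 ≤ h x :=
    X.le_of_subharmonic_sub hS' (f := fun _ => 0)
      (fun x hx hxS => by rw [hh x hx hxS, avg_const, sub_self])
      (fun x hx hxS => by rw [hhS x hx hxS]; split_ifs <;> norm_num)
  have hle : ∀ x ∈ Set.Icc b a, h x ≤ 1 :=
    X.le_of_subharmonic_sub hS' (g := fun _ => 1)
      (fun x hx hxS => by rw [hh x hx hxS, avg_const, sub_self])
      (fun x hx hxS => by rw [hhS x hx hxS]; split_ifs <;> norm_num)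
  set f := X.meanHit {0} with hf
  set E := X.meanHit S 0 with hE
  set κ := m 0 * (X.avg h 0 - h 0) with hκ
  set τ := ‖ζ - 1‖ with hτ
  have hfx : ∀ x ∈ Set.Icc b a, x ≠ 0 → f x - X.avg f x = 1 := fun x hx hx0 =>
    X.meanHit_sub_avg ⟨0, Set.mem_singleton 0, h0⟩ hx (by simpa using hx0)
  have hf0 : f 0 = 0 := X.meanHit_of_mem rfl
  have hfnn : ∀ x, 0 ≤ f x := X.meanHit_nonneg {0}
  -- the generating function is nearly constant away from `S`
  have hv : ∀ x ∈ Set.Icc b a, ‖u x - u 0‖ ≤ 2 * h x + τ * f x := by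
    refine X.le_of_subharmonic_sub hS' (f := fun x => ‖u x - u 0‖)
      (g := fun x => 2 * h x + τ * f x) (fun x hx hxS => ?_) (fun x hx hxS => ?_)
    · simp only [Set.mem_insert_iff, not_or] at hxS
      have h1 := hh x hx (by simp [hxS])
      have h2 := hfx x hx hxS.1
      rw [avg_add, avg_const_mul, avg_const_mul]
      have h3 : X.avg h x = h x := by linarith
      have h4 : X.avg f x = f x - 1 := by linarith
      rw [h3, h4]
      have h5 : u x - u 0 = ζ * X.avg (fun y => u y - u 0) x + (ζ - 1) * u 0 := by
        rw [avg_sub, avg_const, hu x hx hxS.2]; ring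
      have h6 : ‖X.avg (fun y => u y - u 0) x‖ ≤ X.avg (fun y => ‖u y - u 0‖) x := by
        rw [avg_complex, avg_real]
        refine (norm_add₃_le).trans (le_of_eq ?_)
        simp
      have h7 : ‖u x - u 0‖ ≤ X.avg (fun y => ‖u y - u 0‖) x + τ := by
        calc ‖u x - u 0‖ = ‖ζ * X.avg (fun y => u y - u 0) x + (ζ - 1) * u 0‖ := by rw [← h5]
          _ ≤ ‖ζ‖ * ‖X.avg (fun y => u y - u 0) x‖ + τ * ‖u 0‖ := by
              rw [hτ, ← norm_mul, ← norm_mul]; exact norm_add_le _ _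
          _ ≤ 1 * X.avg (fun y => ‖u y - u 0‖) x + τ * 1 := by
              rw [hζ]; gcongr; exact hu1 0
          _ = _ := by ring
      linarith
    · rcases hxS with rfl | hxS
      · simp [hh0, hf0]
      · rw [hh1 x hx hxS]
        have h1 := norm_sub_le (u x) (u 0)
        have h2 : 0 ≤ τ * f x := mul_nonneg (norm_nonneg _) (hfnn x)
        linarith [hu1 x, hu1 0]
  -- The test function `1 - h` vanishes on `S`, exactly where the equations for `u` and for the mean
  -- fail.
  have hsmul : ∀ {E' : Type} [AddCommGroup E'] [Module ℝ E'] (F : ℤ → E'),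
      ∑ x ∈ Finset.Icc b a, (m x * (1 - h x)) • (F x - X.avg F x) =
        -∑ x ∈ Finset.Icc b a, (m x * (h x - X.avg h x)) • F x := by
    intro E' _ _ F
    have := X.sum_smul_avg hm (fun x => 1 - h x) F
    simp only [smul_sub, Finset.sum_sub_distrib]
    rw [this, ← Finset.sum_sub_distrib, ← Finset.sum_neg_distrib]
    refine Finset.sum_congr rfl fun x _ => ?_
    rw [avg_sub, avg_const, ← sub_smul, ← neg_smul]
    congr 1
    ring
  have hu_sum : (κ : ℂ) * (1 - u 0) =
      (ζ⁻¹ - 1) * ∑ x ∈ Finset.Icc b a, ((m x * (1 - h x) : ℝ) : ℂ) * u x := by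
    have h1 := hsmul u
    rw [X.sum_smul_sub_avg_eq hm h0 hh huS, ← hκ, Complex.real_smul] at h1
    rw [← neg_inj, ← h1, Finset.mul_sum, ← Finset.sum_neg_distrib]
    refine Finset.sum_congr rfl fun x hx => ?_
    have hx' : x ∈ Set.Icc b a := by simpa using hx
    rw [Complex.real_smul]
    by_cases hxS : x ∈ S
    · simp [hh1 x hx' hxS]
    · have : X.avg u x = ζ⁻¹ * u x := by rw [hu x hx' hxS, inv_mul_cancel_left₀ hζ0]
      rw [this]; ring
  have hE_sum : ∑ x ∈ Finset.Icc b a, m x * (1 - h x) = κ * E := by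
    have h1 := hsmul (X.meanHit S)
    rw [X.sum_smul_sub_avg_eq hm h0 hh (c := 0) (fun x _ hxS => X.meanHit_of_mem hxS), ← hκ,
      smul_eq_mul, ← hE] at h1
    have h2 : κ * E = -(κ * (0 - E)) := by ring
    rw [h2, ← h1]
    refine Finset.sum_congr rfl fun x hx => ?_
    have hx' : x ∈ Set.Icc b a := by simpa using hx
    by_cases hxS : x ∈ S
    · simp [hh1 x hx' hxS]
    · rw [X.meanHit_sub_avg hS hx' hxS, smul_eq_mul, mul_one]
  -- As `h 0 = 0` and `f` has defect one elsewhere, symmetry turns the sum into the integral of `f`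
  -- against the charge of `h`. On `S` this charge is nonnegative and `f ≤ D`; at `0`, `f` vanishes.
  have hh_sum : ∑ x ∈ Finset.Icc b a, m x * h x ≤ κ * D := by
    have h1 := X.sum_smul_sub_avg_eq hm h0 hh (F := fun x => if x = 0 then 0 else D) (c := D)
      (fun x hx hxS => if_neg (by rintro rfl; exact h0S hxS))
    rw [if_pos rfl, sub_zero, smul_eq_mul, ← hκ] at h1
    rw [← h1]
    have h2 : ∑ x ∈ Finset.Icc b a, m x * h x =
        ∑ x ∈ Finset.Icc b a, (m x * (h x - X.avg h x)) * f x := by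
      have h3 := X.sum_smul_avg hm h f
      simp only [smul_eq_mul] at h3
      simp only [mul_sub, sub_mul, Finset.sum_sub_distrib]
      rw [← h3, ← Finset.sum_sub_distrib]
      refine Finset.sum_congr rfl fun x hx => ?_
      have hx' : x ∈ Set.Icc b a := by simpa using hx
      by_cases hx0 : x = 0
      · simp [hx0, hh0]
      · have h4 := hfx x hx' hx0
        rw [← mul_sub, h4, mul_one]
    rw [h2]
    refine Finset.sum_le_sum fun x hx => ?_
    have hx' : x ∈ Set.Icc b a := by simpa using hx
    rw [smul_eq_mul]
    by_cases hx0 : x = 0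
    · simp [hx0, hf0]
    rw [if_neg hx0]
    by_cases hxS : x ∈ S
    · have h5 : X.avg h x ≤ 1 := by
        rw [← X.avg_const (1 : ℝ) x]; exact X.avg_mono_real hle hx'
      refine mul_le_mul_of_nonneg_left (hD x hx') (mul_nonneg (hm0 x) ?_)
      rw [hh1 x hx' hxS]; linarith
    · rw [hh x hx' (by simp [hx0, hxS])]; simp
  have hEnn : 0 ≤ E := X.meanHit_nonneg S 0
  have hκE : 0 < κ * E := by
    rw [← hE_sum]
    refine Finset.sum_pos' (fun x hx => ?_) ⟨0, by simpa using h0, ?_⟩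
    · exact mul_nonneg (hm0 x) (by linarith [hle x (by simpa using hx)])
    · rw [hh0, sub_zero, mul_one]; exact hmpos 0 h0
  have hκpos : 0 < κ := pos_of_mul_pos_left hκE hEnn
  have hvsum : ‖∑ x ∈ Finset.Icc b a, ((m x * (1 - h x) : ℝ) : ℂ) * (u x - u 0)‖ ≤
      κ * (2 * D + τ * (D * E)) := by
    calc _ ≤ ∑ x ∈ Finset.Icc b a, (2 * (m x * h x) + τ * D * (m x * (1 - h x))) := by
          refine (norm_sum_le _ _).trans (Finset.sum_le_sum fun x hx => ?_)
          have hx' : x ∈ Set.Icc b a := by simpa using hx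
          have h1 := hle x hx'
          have h2 := hnn x hx'
          have h3 := hm0 x
          have h4 : 0 ≤ m x * (1 - h x) := mul_nonneg h3 (by linarith)
          rw [norm_mul, Complex.norm_real, Real.norm_of_nonneg h4]
          calc m x * (1 - h x) * ‖u x - u 0‖ ≤ m x * (1 - h x) * (2 * h x + τ * D) := by
                refine mul_le_mul_of_nonneg_left ((hv x hx').trans ?_) h4
                gcongr
                exact hD x hx'
            _ = 2 * (m x * h x) - 2 * (m x * h x ^ 2) + τ * D * (m x * (1 - h x)) := by ring
            _ ≤ _ := by
                have : 0 ≤ m x * h x ^ 2 := by positivity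
                linarith
      _ = 2 * ∑ x ∈ Finset.Icc b a, m x * h x + τ * D * (κ * E) := by
          rw [Finset.sum_add_distrib, ← Finset.mul_sum, ← Finset.mul_sum, hE_sum]
      _ ≤ 2 * (κ * D) + τ * D * (κ * E) := by gcongr
      _ = _ := by ring
  -- Subtracting `u 0` times the identity for the mean from the one for `u` leaves only the
  -- oscillation of `u`.
  have hmain : (κ : ℂ) * (1 - u 0 * (1 + (ζ⁻¹ - 1) * E)) =
      (ζ⁻¹ - 1) * ∑ x ∈ Finset.Icc b a, ((m x * (1 - h x) : ℝ) : ℂ) * (u x - u 0) := by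
    simp only [mul_sub ((_ : ℝ) : ℂ), Finset.sum_sub_distrib, ← Finset.sum_mul]
    rw [← Complex.ofReal_sum, hE_sum, mul_sub (ζ⁻¹ - 1), ← hu_sum]
    push_cast
    ring
  have hinv : ‖ζ⁻¹ - 1‖ = τ := by
    have : ζ⁻¹ - 1 = -(ζ⁻¹ * (ζ - 1)) := by rw [mul_sub, inv_mul_cancel₀ hζ0]; ring
    rw [this, norm_neg, norm_mul, norm_inv, hζ, inv_one, one_mul]
  have h1 := congrArg norm hmain
  rw [norm_mul, norm_mul, hinv, Complex.norm_real, Real.norm_of_nonneg hκpos.le] at h1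
  refine le_of_mul_le_mul_left ?_ hκpos
  rw [h1]
  calc _ ≤ τ * (κ * (2 * D + τ * (D * E))) := by gcongr
    _ = _ := by ring

end BirthDeathChain

/-! ### Exponential characteristic function and Chebyshev's inequality -/

lemma toReal_coe_enat (t : ℕ∞) : ((t : ℝ≥0∞)).toReal = t.toNat := by
  induction t <;> simp

lemma measurable_meanNormalized {Ω : Type*} [MeasurableSpace Ω] (μ : Measure Ω) {T : Ω → ℕ∞}
    (hT : Measurable T) : Measurable (meanNormalized μ T) := by
  unfold meanNormalized
  fun_prop

lemma charFun_map_id_expMeasure_one (s : ℝ) :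
    charFun ((expMeasure 1).map id) s = (1 - s * Complex.I)⁻¹ := by
  rw [Measure.map_id, charFun_apply_real, expMeasure, gammaMeasure]
  have hm : Measurable (gammaPDF 1 1) := (measurable_gammaPDFReal 1 1).ennreal_ofReal
  rw [integral_withDensity_eq_integral_toReal_smul hm
    (Eventually.of_forall fun x => ENNReal.ofReal_lt_top)]
  have h : ∀ x : ℝ, (gammaPDF 1 1 x).toReal • Complex.exp (s * x * Complex.I) =
      (Set.Ici (0 : ℝ)).indicator
        (fun x : ℝ => Complex.exp ((s * Complex.I - 1) * x)) x := by
    intro x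
    rw [gammaPDF_eq]
    by_cases hx : 0 ≤ x
    · rw [if_pos hx, Set.indicator_of_mem (Set.mem_Ici.2 hx)]
      simp only [Real.one_rpow, Real.Gamma_one, sub_self, Real.rpow_zero, one_mul, div_one]
      rw [ENNReal.toReal_ofReal (Real.exp_pos _).le, Complex.real_smul, Complex.ofReal_exp,
        ← Complex.exp_add]
      congr 1
      push_cast
      ring
    · rw [if_neg hx, Set.indicator_of_notMem (by simpa using hx)]
      simp
  simp only [h]
  rw [integral_indicator measurableSet_Ici, integral_Ici_eq_integral_Ioi,
    integral_exp_mul_complex_Ioi (by simp)]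
  have h1 : (1 - s * Complex.I : ℂ) ≠ 0 := fun h0 => by simpa using congrArg Complex.re h0
  have h2 : (s * Complex.I - 1 : ℂ) ≠ 0 := fun h0 => h1 (by rw [← neg_sub, h0, neg_zero])
  simp only [Complex.ofReal_zero, mul_zero, Complex.exp_zero]
  rw [div_eq_iff h2]
  field_simp
  ring

/-- Chebyshev's inequality for a random time divided by its mean. -/
lemma measure_le_abs_meanNormalized_sub_one {Ω : Type*} [MeasurableSpace Ω] {μ : Measure Ω}
    [IsProbabilityMeasure μ] {T : Ω → ℕ∞} (hT : Measurable T) {f C : ℝ} (hf : 0 < f)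
    (hm : ∫⁻ ω, (T ω : ℝ≥0∞) ∂μ = ENNReal.ofReal f) (hC : 0 ≤ C)
    (h2 : ∫⁻ ω, (T ω : ℝ≥0∞) ^ 2 ∂μ ≤ ENNReal.ofReal (f ^ 2 + C * f)) {ε : ℝ} (hε : 0 < ε) :
    μ {ω | ε ≤ |meanNormalized μ T ω - 1|} ≤ ENNReal.ofReal (C / f / ε ^ 2) := by
  set R : Ω → ℝ := fun ω => (T ω : ℝ≥0∞).toReal with hR
  have hTm : Measurable fun ω => (T ω : ℝ≥0∞) := by fun_prop
  have hT2m : Measurable fun ω => (T ω : ℝ≥0∞) ^ 2 := by fun_prop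
  have hfin1 : ∫⁻ ω, (T ω : ℝ≥0∞) ∂μ ≠ ⊤ := by rw [hm]; exact ENNReal.ofReal_ne_top
  have hfin2 : ∫⁻ ω, (T ω : ℝ≥0∞) ^ 2 ∂μ ≠ ⊤ := (h2.trans_lt ENNReal.ofReal_lt_top).ne
  have hi1 : Integrable R μ := integrable_toReal_of_lintegral_ne_top hTm.aemeasurable hfin1
  have hi2 : Integrable (fun ω => R ω ^ 2) μ := by
    have := integrable_toReal_of_lintegral_ne_top hT2m.aemeasurable hfin2
    simpa [hR] using this
  have he1 : ∫ ω, R ω ∂μ = f := by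
    rw [hR, integral_toReal hTm.aemeasurable (ae_lt_top hTm hfin1), hm,
      ENNReal.toReal_ofReal hf.le]
  have he2 : ∫ ω, R ω ^ 2 ∂μ ≤ f ^ 2 + C * f := by
    have h3 : ∫ ω, R ω ^ 2 ∂μ = ∫ ω, ((T ω : ℝ≥0∞) ^ 2).toReal ∂μ := by simp [hR]
    rw [h3, integral_toReal hT2m.aemeasurable (ae_lt_top hT2m hfin2)]
    exact ENNReal.toReal_le_of_le_ofReal (by positivity) h2
  have hvar : ∫ ω, (R ω - f) ^ 2 ∂μ ≤ C * f := by
    have h4 : ∀ ω, (R ω - f) ^ 2 = R ω ^ 2 - 2 * f * R ω + f ^ 2 := fun ω => by ring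
    simp only [h4]
    have hi3 : Integrable (fun ω => 2 * f * R ω) μ := hi1.const_mul _
    have h8 : Integrable (fun ω => R ω ^ 2 - 2 * f * R ω) μ := hi2.sub hi3
    rw [integral_add h8 (integrable_const _), integral_sub hi2 hi3, integral_const_mul, he1]
    simp only [integral_const, probReal_univ, smul_eq_mul, one_mul]
    nlinarith
  have hi4 : Integrable (fun ω => (R ω - f) ^ 2) μ := by
    have h4 : ∀ ω, (R ω - f) ^ 2 = R ω ^ 2 - 2 * f * R ω + f ^ 2 := fun ω => by ring
    simp only [h4]
    exact (hi2.sub (hi1.const_mul _)).add (integrable_const _)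
  have hmark := mul_meas_ge_le_integral_of_nonneg
    (Eventually.of_forall fun ω => sq_nonneg (R ω - f)) hi4 ((ε * f) ^ 2)
  have hset : {ω | ε ≤ |meanNormalized μ T ω - 1|} = {ω | (ε * f) ^ 2 ≤ (R ω - f) ^ 2} := by
    ext ω
    have h5 : meanNormalized μ T ω = R ω / f := by
      rw [meanNormalized, hm, ENNReal.toReal_div, ENNReal.toReal_ofReal hf.le]
    simp only [Set.mem_ofPred_eq]
    rw [h5, ← sq_le_sq₀ hε.le (abs_nonneg _), sq_abs, mul_pow, ← le_div_iff₀ (by positivity),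
      ← div_pow, sub_div, div_self hf.ne']
  rw [hset, ← ofReal_measureReal]
  refine ENNReal.ofReal_le_ofReal ?_
  rw [div_div, le_div_iff₀ (by positivity)]
  have h6 := hmark.trans hvar
  have h7 : μ.real {ω | (ε * f) ^ 2 ≤ (R ω - f) ^ 2} * (f * ε ^ 2) * f ≤ C * f := by
    calc _ = (ε * f) ^ 2 * μ.real {ω | (ε * f) ^ 2 ≤ (R ω - f) ^ 2} := by ring
      _ ≤ _ := h6
  exact le_of_mul_le_mul_right h7 hf

/-! ### Hitting times on the unit circle, and mirror images -/

namespace BirthDeathChain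

variable {b a : ℤ} (X : BirthDeathChain b a)

/-- The generating function of the hitting time of `S`. -/
noncomputable def hitGenFun (S : Set ℤ) (ζ : ℂ) (x : ℤ) : ℂ :=
  ∫ ω, ζ ^ (hitTime S ω).toNat ∂X.pathLaw x

lemma measurable_pow_hitTime (S : Set ℤ) (ζ : ℂ) :
    Measurable fun ω => ζ ^ (hitTime S ω).toNat :=
  (Measurable.of_discrete (f := fun t : ℕ∞ => ζ ^ t.toNat)).comp (measurable_hitTime S)

lemma norm_pow_toNat_le {ζ : ℂ} (hζ : ‖ζ‖ = 1) (t : ℕ∞) : ‖ζ ^ t.toNat‖ ≤ 1 := by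
  rw [norm_pow, hζ, one_pow]

lemma norm_hitGenFun_le (S : Set ℤ) {ζ : ℂ} (hζ : ‖ζ‖ = 1) (x : ℤ) :
    ‖X.hitGenFun S ζ x‖ ≤ 1 := by
  have := norm_integral_le_of_norm_le_const (μ := X.pathLaw x) (C := 1)
    (Eventually.of_forall fun ω => norm_pow_toNat_le hζ (hitTime S ω))
  simpa [hitGenFun] using this

lemma hitGenFun_of_mem {S : Set ℤ} {ζ : ℂ} (hζ : ‖ζ‖ = 1) {x : ℤ} (hx : x ∈ S) :
    X.hitGenFun S ζ x = 1 := by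
  rw [hitGenFun, integral_pathLaw X x (measurable_pow_hitTime S ζ).stronglyMeasurable
    (fun ω => norm_pow_toNat_le hζ _)]
  simp [hitTime_prepend_of_mem hx, avg_const]

lemma ae_hitTime_ne_top {S : Set ℤ} (hS : (S ∩ Set.Icc b a).Nonempty) {x : ℤ}
    (hx : x ∈ Set.Icc b a) : ∀ᵐ ω ∂X.pathLaw x, hitTime S ω ≠ ⊤ := by
  filter_upwards [ae_lt_top (by fun_prop) (X.meanHitTime_ne_top hS hx)] with ω hω
  simpa [lt_top_iff_ne_top] using hω

lemma hitGenFun_of_notMem {S : Set ℤ} (hS : (S ∩ Set.Icc b a).Nonempty) {ζ : ℂ} (hζ : ‖ζ‖ = 1)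
    {x : ℤ} (hx : x ∈ Set.Icc b a) (hxS : x ∉ S) :
    X.hitGenFun S ζ x = ζ * X.avg (X.hitGenFun S ζ) x := by
  rw [hitGenFun, integral_pathLaw X x (measurable_pow_hitTime S ζ).stronglyMeasurable
    (fun ω => norm_pow_toNat_le hζ _)]
  have h : ∀ y ∈ Set.Icc b a, ∫ ω, ζ ^ (hitTime S (prepend x ω)).toNat ∂X.pathLaw y =
      ζ * X.hitGenFun S ζ y := by
    intro y hy
    rw [hitGenFun, ← integral_const_mul]
    refine integral_congr_ae ?_
    -- `toNat` sends `⊤` to `0` and would lose the shift by one, so almost sure finiteness is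
    -- needed.
    filter_upwards [X.ae_hitTime_ne_top hS hy] with ω hω
    rw [hitTime_prepend_of_notMem hxS, ENat.toNat_add hω ENat.one_ne_top, ENat.toNat_one,
      pow_succ']
  rw [X.avg_congr h hx, avg_complex, avg_complex]
  ring

/-- Dividing the time by its mean amounts to evaluating the generating function at `exp (i s / E)`.
-/
lemma charFun_meanNormalized_hitTime {S : Set ℤ} (x : ℤ) (s : ℝ) :
    charFun ((X.pathLaw x).map (meanNormalized (X.pathLaw x) (hitTime S))) s =
      X.hitGenFun S (Complex.exp ((s / X.meanHit S x : ℝ) * Complex.I)) x := by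
  rw [charFun_apply_real, integral_map
    (measurable_meanNormalized _ (measurable_hitTime S)).aemeasurable (by fun_prop), hitGenFun]
  congr 1
  ext ω
  rw [← Complex.exp_nat_mul]
  congr 1
  rw [meanNormalized, ENNReal.toReal_div, toReal_coe_enat]
  change (s : ℂ) * (((hitTime S ω).toNat / X.meanHit S x : ℝ) : ℂ) * Complex.I = _
  push_cast
  ring

/-- The mirror image of a chain. -/
def reflect : BirthDeathChain (-a) (-b) where
  p x := X.q (-x)
  q x := X.p (-x)
  p_pos_iff x := by rw [X.q_pos_iff]; omega
  q_pos_iff x := by rw [X.p_pos_iff]; omega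
  p_add_q_le_one x := by rw [add_comm]; exact X.p_add_q_le_one (-x)

lemma stepLaw_reflect_singleton (x y : ℤ) : X.reflect.stepLaw x {y} = X.stepLaw (-x) {-y} := by
  rw [stepLaw_singleton, stepLaw_singleton, avg_ennreal, avg_ennreal]
  have h1 : X.reflect.r x = X.r (-x) := by simp [r, reflect, add_comm]
  have h2 : y = x + 1 ↔ -y = -x - 1 := by omega
  have h3 : y = x - 1 ↔ -y = -x + 1 := by omega
  rw [h1]
  simp only [h2, h3, neg_inj, reflect]
  ring

lemma pathLaw_reflect (x : ℤ) :
    X.reflect.pathLaw x = (X.pathLaw (-x)).map (fun ω n => -ω n) := by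
  have hm : Measurable fun (ω : ℕ → ℤ) (n : ℕ) => -ω n := by fun_prop
  have := Measure.isProbabilityMeasure_map (μ := X.pathLaw (-x)) hm.aemeasurable
  refine ext_of_pathCylinder fun c n => ?_
  have h : (fun (ω : ℕ → ℤ) (n : ℕ) => -ω n) ⁻¹' pathCylinder c n =
      pathCylinder (fun i => -c i) n := by
    ext ω
    simp only [pathCylinder, Set.mem_preimage, Set.mem_ofPred_eq, neg_eq_iff_eq_neg]
  rw [Measure.map_apply hm (measurableSet_pathCylinder c n), h, pathLaw_pathCylinder,
    pathLaw_pathCylinder]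
  simp only [stepLaw_reflect_singleton, neg_inj]

lemma hitTime_neg (y : ℤ) (ω : ℕ → ℤ) : hitTime {y} (fun n => -ω n) = hitTime {-y} ω := by
  simp only [hitTime, Set.mem_singleton_iff, neg_eq_iff_eq_neg]

lemma lintegral_hitTime_reflect (x y : ℤ) (k : ℕ) :
    ∫⁻ ω, (hitTime {y} ω : ℝ≥0∞) ^ k ∂X.reflect.pathLaw x =
      ∫⁻ ω, (hitTime {-y} ω : ℝ≥0∞) ^ k ∂X.pathLaw (-x) := by
  rw [pathLaw_reflect, lintegral_map (by fun_prop) (by fun_prop)]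
  simp only [hitTime_neg]

lemma meanHit_reflect (x y : ℤ) : X.reflect.meanHit {y} x = X.meanHit {-y} (-x) := by
  have := X.lintegral_hitTime_reflect x y 1
  simp only [pow_one] at this
  rw [meanHit, meanHit, meanHitTime, meanHitTime, this]

lemma reflect_q_ge {δ : ℝ} (hp : ∀ x ∈ Set.Icc b (-1), δ ≤ X.p x) :
    ∀ x ∈ Set.Icc 1 (-b), δ ≤ X.reflect.q x :=
  fun x hx => hp (-x) ⟨by linarith [hx.2], by linarith [hx.1]⟩

lemma reflect_q_mul_meanHit_le {K : ℝ}
    (hK : ∀ x ∈ Set.Icc b (-1), X.p x * X.meanHit {x + 1} x ≤ K) :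
    ∀ x ∈ Set.Icc 1 (-b), X.reflect.q x * X.reflect.meanHit {x - 1} x ≤ K := by
  intro x hx
  rw [meanHit_reflect, show -(x - 1) = -x + 1 by ring]
  exact hK (-x) ⟨by linarith [hx.2], by linarith [hx.1]⟩

theorem lintegral_sq_hitTime_zero_le_left (ha : 0 ≤ a) {δ K : ℝ} (hδ : 0 < δ)
    (hp : ∀ x ∈ Set.Icc b (-1), δ ≤ X.p x)
    (hK : ∀ x ∈ Set.Icc b (-1), X.p x * X.meanHit {x + 1} x ≤ K) (hb : b < 0) :
    ∫⁻ ω, (hitTime {0} ω : ℝ≥0∞) ^ 2 ∂X.pathLaw b ≤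
      ENNReal.ofReal (X.meanHit {0} b ^ 2 + 2 * K ^ 2 / δ * X.meanHit {0} b) := by
  have := X.reflect.lintegral_sq_hitTime_zero_le (by omega) hδ (X.reflect_q_ge hp)
    (X.reflect_q_mul_meanHit_le hK) (by omega)
  simpa [lintegral_hitTime_reflect, meanHit_reflect] using this

theorem sq_meanHit_zero_le_left (ha : 0 ≤ a) {δ K : ℝ} (hδ : 0 < δ)
    (hp : ∀ x ∈ Set.Icc b (-1), δ ≤ X.p x)
    (hK : ∀ x ∈ Set.Icc b (-1), X.p x * X.meanHit {x + 1} x ≤ K) (hδ1 : δ ≤ 1)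
    (hb : b < 0) :
    δ ^ 2 * X.meanHit {0} b ^ 2 ≤ 2 * K ^ 2 * X.meanHit {b} 0 := by
  have := X.reflect.sq_meanHit_zero_le (by omega) hδ (X.reflect_q_ge hp)
    (X.reflect_q_mul_meanHit_le hK) hδ1 (by omega)
  simpa [meanHit_reflect] using this

lemma meanHit_zero_le_right (hb : b ≤ 0) {x : ℤ} (hx : 0 ≤ x) (hxa : x ≤ a) :
    X.meanHit {0} x ≤ X.meanHit {0} a := by
  induction x, hxa using Int.leInductionDown with
  | base => exact le_rfl
  | pred n hn ih =>
    have := X.meanHit_zero_sub_nonneg hb hn (by omega)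
    linarith [ih (by omega)]

/-- The mean return time grows away from `0` on both sides, so the ends are the worst states; this
provides the `D` of `norm_one_sub_mul_le`. -/
lemma meanHit_zero_le_max (hb : b ≤ 0) (ha : 0 ≤ a) {x : ℤ} (hx : x ∈ Set.Icc b a) :
    X.meanHit {0} x ≤ max (X.meanHit {0} a) (X.meanHit {0} b) := by
  rcases le_total 0 x with h | h
  · exact (X.meanHit_zero_le_right hb h hx.2).trans (le_max_left _ _)
  · have := X.reflect.meanHit_zero_le_right (x := -x) (by omega) (by omega) (by linarith [hx.1])
    simp only [meanHit_reflect, neg_neg, neg_zero] at this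
    exact this.trans (le_max_right _ _)

end BirthDeathChain

/-! ### Asymptotics along the family -/

/-- This is the difference quotient at `0` of `t ↦ exp (-i s t)`, taken at `t = 1 / E`. -/
lemma tendsto_mul_exp_sub_one {ι : Type*} {l : Filter ι} {E : ι → ℝ} (hE : Tendsto E l atTop)
    (s : ℝ) : Tendsto (fun i => ((Complex.exp ((s / E i : ℝ) * Complex.I))⁻¹ - 1) * (E i : ℂ)) l
      (𝓝 (-(s * Complex.I))) := by
  have h1 : HasDerivAt (fun t : ℝ => Complex.exp (-(s * t * Complex.I)))
      (-(s * Complex.I)) 0 := by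
    have h : HasDerivAt (fun t : ℝ => -((s : ℂ) * t * Complex.I)) (-(s * Complex.I)) 0 := by
      have := (((Complex.ofRealCLM.hasDerivAt (x := (0 : ℝ))).const_mul (s : ℂ)).mul_const
        Complex.I).fun_neg
      simpa using this
    simpa using h.cexp
  have h2 := h1.tendsto_slope_zero
  have h3 : Tendsto (fun i => (E i)⁻¹) l (𝓝[≠] 0) :=
    (tendsto_inv_atTop_nhdsGT_zero.mono_right (nhdsGT_le_nhdsNE 0)).comp hE
  refine (h2.comp h3).congr fun i => ?_
  simp only [Function.comp, zero_add, inv_inv, Complex.ofReal_zero, mul_zero, zero_mul, neg_zero,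
    Complex.exp_zero, Complex.real_smul]
  rw [mul_comm, ← Complex.exp_neg]
  push_cast
  congr 3

lemma norm_exp_mul_I_sub_one_le (t : ℝ) : ‖Complex.exp (t * Complex.I) - 1‖ ≤ |t| := by
  have := Real.norm_exp_I_mul_ofReal_sub_one_le (x := t)
  rw [mul_comm]
  simpa using this

namespace BirthDeathChain

variable {b a : ℤ} (X : BirthDeathChain b a)

lemma toReal_mul_meanHitTime_le {c : ℝ≥0} {x : ℤ} {S : Set ℤ} {K : ℝ≥0∞} (hK : K ≠ ⊤)
    (h : (c : ℝ≥0∞) * X.meanHitTime x S ≤ K) : c * X.meanHit S x ≤ K.toReal := by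
  have := ENNReal.toReal_mono hK h
  rwa [ENNReal.toReal_mul, ENNReal.coe_toReal] at this

lemma q_mul_meanHit_le_rightConst (h : X.rightConst ≠ ⊤) :
    ∀ x ∈ Set.Icc 1 a, X.q x * X.meanHit {x - 1} x ≤ X.rightConst.toReal := fun x hx =>
  X.toReal_mul_meanHitTime_le h (le_iSup₂_of_le (f := fun x (_ : x ∈ Set.Icc (1 : ℤ) a) =>
    (X.q x : ℝ≥0∞) * X.meanHitTime x {x - 1}) x hx le_rfl)

lemma p_mul_meanHit_le_leftConst (h : X.leftConst ≠ ⊤) :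
    ∀ x ∈ Set.Icc b (-1), X.p x * X.meanHit {x + 1} x ≤ X.leftConst.toReal := fun x hx =>
  X.toReal_mul_meanHitTime_le h (le_iSup₂_of_le (f := fun x (_ : x ∈ Set.Icc b (-1 : ℤ)) =>
    (X.p x : ℝ≥0∞) * X.meanHitTime x {x + 1}) x hx le_rfl)

end BirthDeathChain

lemma ne_top_of_sq_div_lt_one {K m : ℝ≥0∞} (hm : m ≠ ⊤) (h : K ^ 2 / m < 1) : K ≠ ⊤ := by
  rintro rfl
  rw [ENNReal.top_pow two_ne_zero, ENNReal.top_div_of_ne_top hm] at h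
  exact absurd h (by simp)

/-- The minimum with `1` keeps `δ` finite when the infimum is over no states at all, as on the left
of a half well, and provides the bound `δ ≤ 1`. -/
lemma exists_pos_le_one_le {c : ℝ≥0∞} (hc : 0 < c) :
    ∃ δ : ℝ, 0 < δ ∧ δ ≤ 1 ∧ ∀ t : ℝ≥0, c ≤ t → δ ≤ t := by
  have h1 : min c 1 ≠ ⊤ := ((min_le_right c 1).trans_lt ENNReal.one_lt_top).ne
  refine ⟨(min c 1).toReal, ENNReal.toReal_pos (lt_min hc one_pos).ne' h1, ?_, fun t ht => ?_⟩
  · simpa using ENNReal.toReal_mono ENNReal.one_ne_top (min_le_right c 1)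
  · simpa using ENNReal.toReal_mono ENNReal.coe_ne_top ((min_le_left c 1).trans ht)

lemma tendsto_toReal_div {ι : Type*} {l : Filter ι} {u v : ι → ℝ≥0∞}
    (h : Tendsto (fun i => u i / v i) l (𝓝 0)) :
    Tendsto (fun i => (u i).toReal / (v i).toReal) l (𝓝 0) := by
  have := (ENNReal.tendsto_toReal ENNReal.zero_ne_top).comp h
  simpa [Function.comp_def, ENNReal.toReal_div] using this

section Family

variable {b : ℕ+ → ℤ} {X : ∀ a : ℕ+, BirthDeathChain (b a) (a : ℕ)}

lemma pnat_cast_pos (a : ℕ+) : (0 : ℤ) < (a : ℕ) := by exact_mod_cast a.pos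

lemma zero_mem_states (hb : ∀ a, b a ≤ 0) (a : ℕ+) : (0 : ℤ) ∈ Set.Icc (b a) (a : ℕ) :=
  ⟨hb a, (pnat_cast_pos a).le⟩

lemma right_mem_states (hb : ∀ a, b a ≤ 0) (a : ℕ+) : ((a : ℕ) : ℤ) ∈ Set.Icc (b a) (a : ℕ) :=
  ⟨(hb a).trans (pnat_cast_pos a).le, le_rfl⟩

lemma left_mem_states (hb : ∀ a, b a ≤ 0) (a : ℕ+) : b a ∈ Set.Icc (b a) (a : ℕ) :=
  ⟨le_rfl, (hb a).trans (pnat_cast_pos a).le⟩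

lemma nonempty_inter_states {S : Set ℤ} {a : ℕ+} {x : ℤ} (hx : x ∈ Set.Icc (b a) (a : ℕ))
    (hxS : x ∈ S) : (S ∩ Set.Icc (b a) (a : ℕ)).Nonempty := ⟨x, hxS, hx⟩

lemma zero_lt_meanHit_zero_right (hb : ∀ a, b a ≤ 0) (X : ∀ a : ℕ+, BirthDeathChain (b a) (a : ℕ))
    (a : ℕ+) : 0 < (X a).meanHit {0} (a : ℕ) :=
  one_pos.trans_le ((X a).one_le_meanHit
      (nonempty_inter_states (zero_mem_states hb a) (Set.mem_singleton _))
    (right_mem_states hb a) (by simp))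

lemma zero_lt_meanHit_zero_left (hb : ∀ a, b a ≤ 0) (X : ∀ a : ℕ+, BirthDeathChain (b a) (a : ℕ))
    {a : ℕ+} (ha : b a < 0) : 0 < (X a).meanHit {0} (b a) :=
  one_pos.trans_le ((X a).one_le_meanHit
      (nonempty_inter_states (zero_mem_states hb a) (Set.mem_singleton _))
    (left_mem_states hb a) (by simpa using ha.ne))

/-- Real-valued form of the strong drift condition. -/
lemma StrongDriftLeft.exists_real (hb : ∀ a, b a ≤ 0) (h : StrongDriftLeft X) :
    ∃ δ : ℝ, 0 < δ ∧ δ ≤ 1 ∧ ∃ K : ℕ+ → ℝ,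
      (∀ a : ℕ+, ∀ x ∈ Set.Icc (1 : ℤ) (a : ℕ), δ ≤ (X a).q x) ∧
      (∀ᶠ a : ℕ+ in atTop, ∀ x ∈ Set.Icc (1 : ℤ) (a : ℕ),
        (X a).q x * (X a).meanHit {x - 1} x ≤ K a) ∧
      Tendsto (fun a : ℕ+ => K a ^ 2 / (X a).meanHit {0} (a : ℕ)) atTop (𝓝 0) := by
  obtain ⟨h1, h2⟩ := h
  obtain ⟨δ, hδ, hδ1, hδq⟩ := exists_pos_le_one_le h1
  refine ⟨δ, hδ, hδ1, fun a => (X a).rightConst.toReal,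
    fun a x hx => hδq _ (iInf_le_of_le a (iInf₂_le x hx)), ?_, ?_⟩
  -- The constant may be infinite for small `a`; once the ratio is below one it is finite and
  -- `toReal` loses nothing.
  · filter_upwards [h2.eventually_lt_const one_pos] with a ha
    exact (X a).q_mul_meanHit_le_rightConst (ne_top_of_sq_div_lt_one
      ((X a).meanHitTime_ne_top (nonempty_inter_states (zero_mem_states hb a) (Set.mem_singleton _))
        (right_mem_states hb a)) ha)
  · simpa [ENNReal.toReal_pow, BirthDeathChain.meanHit] using tendsto_toReal_div h2

lemma StrongDriftRight.exists_real (hb : ∀ a, b a ≤ 0) (h : StrongDriftRight X) :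
    ∃ δ : ℝ, 0 < δ ∧ δ ≤ 1 ∧ ∃ K : ℕ+ → ℝ,
      (∀ a : ℕ+, ∀ x ∈ Set.Icc (b a) (-1), δ ≤ (X a).p x) ∧
      (∀ᶠ a : ℕ+ in atTop, ∀ x ∈ Set.Icc (b a) (-1),
        (X a).p x * (X a).meanHit {x + 1} x ≤ K a) ∧
      Tendsto (fun a : ℕ+ => K a ^ 2 / (X a).meanHit {0} (b a)) atTop (𝓝 0) := by
  obtain ⟨h1, h2⟩ := h
  obtain ⟨δ, hδ, hδ1, hδq⟩ := exists_pos_le_one_le h1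
  refine ⟨δ, hδ, hδ1, fun a => (X a).leftConst.toReal,
    fun a x hx => hδq _ (iInf_le_of_le a (iInf₂_le x hx)), ?_, ?_⟩
  · filter_upwards [h2.eventually_lt_const one_pos] with a ha
    exact (X a).p_mul_meanHit_le_leftConst (ne_top_of_sq_div_lt_one
      ((X a).meanHitTime_ne_top (nonempty_inter_states (zero_mem_states hb a) (Set.mem_singleton _))
        (left_mem_states hb a)) ha)
  · simpa [ENNReal.toReal_pow, BirthDeathChain.meanHit] using tendsto_toReal_div h2

/-- Cut-off follows from second moments that are asymptotic to the squared means. -/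
lemma cutoffAtMeanTimes_of_lintegral_sq_le (hb : ∀ a, b a ≤ 0) {z : ℕ+ → ℤ}
    (hz : ∀ a, z a ∈ Set.Icc (b a) (a : ℕ)) (hz0 : ∀ᶠ a in atTop, 0 < (X a).meanHit {0} (z a))
    {C : ℕ+ → ℝ} (hC : ∀ a, 0 ≤ C a)
    (h2 : ∀ᶠ a in atTop, ∫⁻ ω, (hitTime {0} ω : ℝ≥0∞) ^ 2 ∂(X a).pathLaw (z a) ≤
      ENNReal.ofReal ((X a).meanHit {0} (z a) ^ 2 + C a * (X a).meanHit {0} (z a)))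
    (hlim : Tendsto (fun a => C a / (X a).meanHit {0} (z a)) atTop (𝓝 0)) :
    CutoffAtMeanTimes (fun a => (X a).pathLaw (z a)) (fun _ => hitTime {0}) := by
  intro ε hε
  have h3 : Tendsto (fun a => ENNReal.ofReal (C a / (X a).meanHit {0} (z a) / ε ^ 2)) atTop
      (𝓝 0) := by
    have := ENNReal.tendsto_ofReal (hlim.div_const (ε ^ 2))
    simpa using this
  refine tendsto_of_tendsto_of_tendsto_of_le_of_le' tendsto_const_nhds h3
    (Eventually.of_forall fun _ => zero_le) ?_
  filter_upwards [h2, hz0] with a ha ha0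
  exact measure_le_abs_meanNormalized_sub_one (measurable_hitTime _) ha0
    ((X a).ofReal_meanHit (nonempty_inter_states (zero_mem_states hb a) (Set.mem_singleton _))
      (hz a)).symm
    (hC a) ha hε

lemma StrongDriftLeft.cutoffAtMeanTimes (hb : ∀ a, b a ≤ 0) (h : StrongDriftLeft X) :
    CutoffAtMeanTimes (fun a => (X a).pathLaw (a : ℕ)) (fun _ => hitTime {0}) := by
  obtain ⟨δ, hδ, -, K, hq, hK, hlim⟩ := h.exists_real hb
  refine cutoffAtMeanTimes_of_lintegral_sq_le hb (right_mem_states hb)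
    (Eventually.of_forall (zero_lt_meanHit_zero_right hb X)) (C := fun a => 2 * K a ^ 2 / δ)
    (fun a => by positivity) ?_ ?_
  · filter_upwards [hK] with a ha
    exact (X a).lintegral_sq_hitTime_zero_le (hb a) hδ (hq a) ha (pnat_cast_pos a)
  · have := hlim.const_mul (2 / δ)
    rw [mul_zero] at this
    exact this.congr fun a => by ring

lemma StrongDriftRight.cutoffAtMeanTimes (hb : ∀ a, b a ≤ 0) (hfull : ∀ᶠ a in atTop, b a < 0)
    (h : StrongDriftRight X) :
    CutoffAtMeanTimes (fun a => (X a).pathLaw (b a)) (fun _ => hitTime {0}) := by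
  obtain ⟨δ, hδ, -, K, hp, hK, hlim⟩ := h.exists_real hb
  refine cutoffAtMeanTimes_of_lintegral_sq_le hb (left_mem_states hb)
    (hfull.mono fun a ha => zero_lt_meanHit_zero_left hb X ha) (C := fun a => 2 * K a ^ 2 / δ)
    (fun a => by positivity) ?_ ?_
  · filter_upwards [hK, hfull] with a ha ha0
    exact (X a).lintegral_sq_hitTime_zero_le_left (pnat_cast_pos a).le hδ (hp a) ha ha0
  · have := hlim.const_mul (2 / δ)
    rw [mul_zero] at this
    exact this.congr fun a => by ring

lemma div_le_of_sq_mul_le {δ f K E : ℝ} (hδ : 0 < δ) (hf : 0 < f) (hE : 0 < E)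
    (h : δ ^ 2 * f ^ 2 ≤ 2 * K ^ 2 * E) : f / E ≤ 2 / δ ^ 2 * (K ^ 2 / f) := by
  rw [div_mul_div_comm, div_le_div_iff₀ hE (by positivity)]
  linarith

/-- The quadratic bound `sq_meanHit_zero_le` controls the ratio by a constant times `K² / f(a)`:
strong drift alone makes the return negligible against the escape through the same end. -/
lemma StrongDriftLeft.tendsto_div (hb : ∀ a, b a ≤ 0) (h : StrongDriftLeft X) :
    Tendsto (fun a => (X a).meanHit {0} (a : ℕ) / (X a).meanHit {((a : ℕ) : ℤ)} 0) atTop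
      (𝓝 0) := by
  obtain ⟨δ, hδ, hδ1, K, hq, hK, hlim⟩ := h.exists_real hb
  have h2 := hlim.const_mul (2 / δ ^ 2)
  rw [mul_zero] at h2
  refine tendsto_of_tendsto_of_tendsto_of_le_of_le' tendsto_const_nhds h2
    (Eventually.of_forall fun a =>
      div_nonneg ((X a).meanHit_nonneg _ _) ((X a).meanHit_nonneg _ _)) ?_
  filter_upwards [hK] with a ha
  exact div_le_of_sq_mul_le hδ (zero_lt_meanHit_zero_right hb X a)
    (one_pos.trans_le ((X a).one_le_meanHit
      (nonempty_inter_states (right_mem_states hb a) (Set.mem_singleton _))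
      (zero_mem_states hb a) (by simpa using (pnat_cast_pos a).ne)))
    ((X a).sq_meanHit_zero_le (hb a) hδ (hq a) ha hδ1 (pnat_cast_pos a))

lemma StrongDriftRight.tendsto_div (hb : ∀ a, b a ≤ 0) (hfull : ∀ᶠ a in atTop, b a < 0)
    (h : StrongDriftRight X) :
    Tendsto (fun a => (X a).meanHit {0} (b a) / (X a).meanHit {b a} 0) atTop (𝓝 0) := by
  obtain ⟨δ, hδ, hδ1, K, hp, hK, hlim⟩ := h.exists_real hb
  have h2 := hlim.const_mul (2 / δ ^ 2)
  rw [mul_zero] at h2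
  refine tendsto_of_tendsto_of_tendsto_of_le_of_le' tendsto_const_nhds h2
    (Eventually.of_forall fun a =>
      div_nonneg ((X a).meanHit_nonneg _ _) ((X a).meanHit_nonneg _ _)) ?_
  filter_upwards [hK, hfull] with a ha ha0
  exact div_le_of_sq_mul_le hδ (zero_lt_meanHit_zero_left hb X ha0)
    (one_pos.trans_le ((X a).one_le_meanHit
      (nonempty_inter_states (left_mem_states hb a) (Set.mem_singleton _))
      (zero_mem_states hb a) (by simpa using ha0.ne')))
    ((X a).sq_meanHit_zero_le_left (pnat_cast_pos a).le hδ (hp a) ha hδ1 ha0)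

/-- If `w` tends to `c ≠ 0` and `u w` tends to `1`, then `u` tends to `c⁻¹`. -/
lemma tendsto_inv_of_norm_one_sub_mul_le {ι : Type*} {l : Filter ι} {u w : ι → ℂ} {r : ι → ℝ}
    {c : ℂ} (hc : c ≠ 0) (hw : Tendsto w l (𝓝 c)) (hr : Tendsto r l (𝓝 0))
    (h : ∀ᶠ i in l, ‖1 - u i * w i‖ ≤ r i) : Tendsto u l (𝓝 c⁻¹) := by
  have h1 : Tendsto (fun i => 1 - u i * w i) l (𝓝 0) := squeeze_zero_norm' h hr
  have h2 : Tendsto (fun i => (1 - (1 - u i * w i)) * (w i)⁻¹) l (𝓝 ((1 - 0) * c⁻¹)) :=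
    (tendsto_const_nhds.sub h1).mul (hw.inv₀ hc)
  rw [sub_zero, one_mul] at h2
  refine h2.congr' ?_
  filter_upwards [hw.eventually_ne hc] with i hi
  rw [sub_sub_cancel, mul_inv_cancel_right₀ hi]

lemma mul_two_mul_add_le {t c D E : ℝ} (ht : 0 ≤ t) (htc : t ≤ c / E) (hD : 0 ≤ D)
    (hE : 0 < E) : t * (2 * D + t * (D * E)) ≤ (2 * c + c ^ 2) * (D / E) := by
  have hc : 0 ≤ c / E := ht.trans htc
  calc t * (2 * D + t * (D * E)) ≤ c / E * (2 * D + c / E * (D * E)) := by gcongr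
    _ = _ := by field_simp

/-- Escape-time behaviour follows if the mean time needed to return to `0` is negligible. -/
theorem escapeAtMeanTimes_of_tendsto (hb : ∀ a, b a ≤ 0)
    (X : ∀ a : ℕ+, BirthDeathChain (b a) (a : ℕ)) (S : ℕ+ → Set ℤ)
    (hS : ∀ a, ((a : ℕ) : ℤ) ∈ S a ∨ b a ∈ S a) (h0S : ∀ᶠ a in atTop, (0 : ℤ) ∉ S a)
    (hlim : Tendsto (fun a => max ((X a).meanHit {0} (a : ℕ)) ((X a).meanHit {0} (b a)) /
      (X a).meanHit (S a) 0) atTop (𝓝 0)) :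
    EscapeAtMeanTimes (fun a => (X a).pathLaw 0) (fun a => hitTime (S a)) := by
  set D : ℕ+ → ℝ := fun a => max ((X a).meanHit {0} (a : ℕ)) ((X a).meanHit {0} (b a)) with hD
  set E : ℕ+ → ℝ := fun a => (X a).meanHit (S a) 0 with hE
  have hne : ∀ a, (S a ∩ Set.Icc (b a) (a : ℕ)).Nonempty := fun a =>
    (hS a).elim (nonempty_inter_states (right_mem_states hb a))
      (nonempty_inter_states (left_mem_states hb a))
  have hD1 : ∀ a, 1 ≤ D a := fun a => le_max_of_le_left
    ((X a).one_le_meanHit (nonempty_inter_states (zero_mem_states hb a) (Set.mem_singleton _))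
      (right_mem_states hb a) (by simp))
  have hEpos : ∀ᶠ a in atTop, 0 < E a := h0S.mono fun a ha =>
    one_pos.trans_le ((X a).one_le_meanHit (hne a) (zero_mem_states hb a) ha)
  -- Return times are at least `1`, so `D / E → 0` forces `E → ∞`.
  have hEtop : Tendsto E atTop atTop := by
    have h1 : Tendsto (fun a => (E a)⁻¹) atTop (𝓝[>] 0) := by
      refine tendsto_nhdsWithin_iff.2 ⟨?_, hEpos.mono fun a ha => inv_pos.2 ha⟩
      refine tendsto_of_tendsto_of_tendsto_of_le_of_le' tendsto_const_nhds hlim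
        (hEpos.mono fun a ha => (inv_pos.2 ha).le) (hEpos.mono fun a ha => ?_)
      rw [inv_eq_one_div]
      exact div_le_div_of_nonneg_right (hD1 a) ha.le
    exact h1.inv_tendsto_nhdsGT_zero.congr fun a => inv_inv _
  have hchar : ∀ s : ℝ, Tendsto (fun a => (X a).hitGenFun (S a)
      (Complex.exp ((s / E a : ℝ) * Complex.I)) 0) atTop (𝓝 (1 - s * Complex.I)⁻¹) := by
    intro s
    have hc : (1 - s * Complex.I : ℂ) ≠ 0 := fun h0 => by simpa using congrArg Complex.re h0
    have hw : Tendsto (fun a => 1 + ((Complex.exp ((s / E a : ℝ) * Complex.I))⁻¹ - 1) *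
        (E a : ℂ)) atTop (𝓝 (1 - s * Complex.I)) := by
      have := (tendsto_mul_exp_sub_one hEtop s).const_add 1
      rwa [← sub_eq_add_neg] at this
    have hr : Tendsto (fun a => (2 * |s| + |s| ^ 2) * (D a / E a)) atTop (𝓝 0) := by
      have := hlim.const_mul (2 * |s| + |s| ^ 2)
      rwa [mul_zero] at this
    refine tendsto_inv_of_norm_one_sub_mul_le hc hw hr ?_
    filter_upwards [h0S, hEpos] with a ha0 haE
    have hζ := Complex.norm_exp_ofReal_mul_I (s / E a)
    have h1 := (X a).norm_one_sub_mul_le (zero_mem_states hb a) (hne a) ha0 (D := D a)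
      (fun x hx => (X a).meanHit_zero_le_max (hb a) (pnat_cast_pos a).le hx)
      (fun x => (X a).norm_hitGenFun_le (S a) hζ x) hζ
      (fun x hx hxS => (X a).hitGenFun_of_notMem (hne a) hζ hx hxS)
      (fun x _ hxS => (X a).hitGenFun_of_mem hζ hxS)
    refine h1.trans ?_
    have h2 := norm_exp_mul_I_sub_one_le (s / E a)
    rw [abs_div, abs_of_pos haE] at h2
    exact mul_two_mul_add_le (norm_nonneg _) h2 (zero_le_one.trans (hD1 a)) haE
  have := isProbabilityMeasure_expMeasure one_pos
  refine ⟨fun a => (measurable_meanNormalized _ (measurable_hitTime _)).aemeasurable,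
    aemeasurable_id, ?_⟩
  -- Lévy's continuity theorem is applied along sequences of indices.
  refine tendsto_of_seq_tendsto fun v hv => ?_
  refine ProbabilityMeasure.tendsto_of_tendsto_charFun fun s => ?_
  have h := (hchar s).comp hv
  refine (h.congr fun n => ?_).trans (le_of_eq ?_)
  · exact ((X (v n)).charFun_meanNormalized_hitTime 0 s).symm
  · rw [← charFun_map_id_expMeasure_one]
    rfl

end Family

/-! ### Negligible return times, and the theorem -/

lemma max_div_le_add {x y E : ℝ} (hx : 0 ≤ x) (hy : 0 ≤ y) (hE : 0 ≤ E) :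
    max x y / E ≤ x / E + y / E := by
  rw [← add_div]
  exact div_le_div_of_nonneg_right (max_le (by linarith) (by linarith)) hE

lemma tendsto_max_div {ι : Type*} {l : Filter ι} {x y E : ι → ℝ} (hx : ∀ i, 0 ≤ x i)
    (hy : ∀ i, 0 ≤ y i) (hE : ∀ i, 0 ≤ E i) (h1 : Tendsto (fun i => x i / E i) l (𝓝 0))
    (h2 : Tendsto (fun i => y i / E i) l (𝓝 0)) :
    Tendsto (fun i => max (x i) (y i) / E i) l (𝓝 0) := by
  have h3 := h1.add h2
  rw [add_zero] at h3
  exact tendsto_of_tendsto_of_tendsto_of_le_of_le tendsto_const_nhds h3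
    (fun i => div_nonneg ((hx i).trans (le_max_left _ _)) (hE i))
    (fun i => max_div_le_add (hx i) (hy i) (hE i))

/-- The mean time needed to leave a well through either end compared to the return times. -/
lemma tendsto_max_div_of_le {ι : Type*} {l : Filter ι} {f g A B E : ι → ℝ} (hf : ∀ i, 0 ≤ f i)
    (hg : ∀ i, 0 ≤ g i) (hA : ∀ᶠ i in l, 0 < A i) (hB : ∀ᶠ i in l, 0 < B i)
    (hE : ∀ i, 0 ≤ E i)
    (hle : ∀ᶠ i in l, A i / (g i + A i) + B i / (f i + B i) - 1 ≤
      (1 / (g i + A i) + 1 / (f i + B i)) * E i)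
    (hfA : Tendsto (fun i => f i / A i) l (𝓝 0)) (hgA : Tendsto (fun i => g i / A i) l (𝓝 0))
    (hfB : Tendsto (fun i => f i / B i) l (𝓝 0)) (hgB : Tendsto (fun i => g i / B i) l (𝓝 0)) :
    Tendsto (fun i => max (f i) (g i) / E i) l (𝓝 0) := by
  have hlim : Tendsto (fun i => (max (f i) (g i) / A i + max (f i) (g i) / B i) * 2) l (𝓝 0) := by
    have h1 : Tendsto (fun i => f i / A i + g i / A i + (f i / B i + g i / B i)) l (𝓝 0) := by
      simpa using (hfA.add hgA).add (hfB.add hgB)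
    have h2 := h1.mul_const 2
    rw [zero_mul] at h2
    refine tendsto_of_tendsto_of_tendsto_of_le_of_le' tendsto_const_nhds h2 ?_ ?_
    · filter_upwards [hA, hB] with i hi hi'
      have : 0 ≤ max (f i) (g i) := (hf i).trans (le_max_left _ _)
      positivity
    · filter_upwards [hA, hB] with i hi hi'
      have h3 := max_div_le_add (hf i) (hg i) hi.le
      have h4 := max_div_le_add (hf i) (hg i) hi'.le
      linarith
  refine tendsto_of_tendsto_of_tendsto_of_le_of_le' tendsto_const_nhds hlim
    (Eventually.of_forall fun i => div_nonneg ((hf i).trans (le_max_left _ _)) (hE i)) ?_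
  -- Once `g / A` and `f / B` are below `1/4`, both fractions in `hle` are at least `3/4`, so its
  -- left side is at least `1/2` and `1 / E ≤ 2 (1 / A + 1 / B)`.
  have hquarter : (0 : ℝ) < 1 / 4 := by norm_num
  filter_upwards [hA, hB, hle, hgA.eventually_lt_const hquarter,
    hfB.eventually_lt_const hquarter] with i hAi hBi hi h1 h2
  have hfi := hf i
  have hgi := hg i
  have hMi : 0 ≤ max (f i) (g i) := hfi.trans (le_max_left _ _)
  have hA' : 1 / (g i + A i) ≤ 1 / A i := one_div_le_one_div_of_le hAi (by linarith)
  have hB' : 1 / (f i + B i) ≤ 1 / B i := one_div_le_one_div_of_le hBi (by linarith)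
  rw [div_lt_iff₀ hAi] at h1
  rw [div_lt_iff₀ hBi] at h2
  have h3 : 3 / 4 ≤ A i / (g i + A i) := by
    rw [le_div_iff₀ (by positivity)]; nlinarith
  have h4 : 3 / 4 ≤ B i / (f i + B i) := by
    rw [le_div_iff₀ (by positivity)]; nlinarith
  have h5 : 1 / 2 ≤ (1 / A i + 1 / B i) * E i := by
    have : (1 / (g i + A i) + 1 / (f i + B i)) * E i ≤ (1 / A i + 1 / B i) * E i :=
      mul_le_mul_of_nonneg_right (add_le_add hA' hB') (hE i)
    linarith
  have hEi : 0 < E i := by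
    rcases (hE i).eq_or_lt with h | h
    · rw [← h, mul_zero] at h5; linarith
    · exact h
  rw [div_le_iff₀ hEi]
  calc max (f i) (g i) = max (f i) (g i) * (1 / 2) * 2 := by ring
    _ ≤ max (f i) (g i) * ((1 / A i + 1 / B i) * E i) * 2 := by gcongr
    _ = _ := by ring

theorem theorem1 (b : ℕ+ → ℤ) (hb : ∀ a, b a ≤ 0)
    (X : ∀ a : ℕ+, BirthDeathChain (b a) (a : ℕ)) :
    -- equality in law of the direct and reverse last passages
    (∀ a : ℕ+, ∀ x ∈ Set.Icc (b a) (a : ℕ), ∀ y ∈ Set.Icc (b a) (a : ℕ),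
      IdentDistrib (timeAfterLastVisit x y) (timeAfterLastVisit y x)
        ((X a).pathLaw x) ((X a).pathLaw y)) ∧
    -- cut-off from the right end, and from the left end of a full well
    (StrongDriftLeft X →
      CutoffAtMeanTimes (fun a => (X a).pathLaw (a : ℕ)) (fun _ => hitTime {0})) ∧
    ((∀ᶠ a in atTop, b a < 0) → StrongDriftRight X →
      CutoffAtMeanTimes (fun a => (X a).pathLaw (b a)) (fun _ => hitTime {0})) ∧
    -- escape in a full well
    ((∀ᶠ a in atTop, b a < 0) → StrongDrift X →
      (Tendsto (fun a => (X a).meanHitTime (b a) {0} / (X a).meanHitTime 0 {((a : ℕ) : ℤ)})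
          atTop (𝓝 0) →
        EscapeAtMeanTimes (fun a => (X a).pathLaw 0) (fun a => hitTime {((a : ℕ) : ℤ)})) ∧
      (Tendsto (fun a => (X a).meanHitTime (a : ℕ) {0} / (X a).meanHitTime 0 {b a})
          atTop (𝓝 0) →
        EscapeAtMeanTimes (fun a => (X a).pathLaw 0) (fun a => hitTime {b a})) ∧
      (Tendsto (fun a => (X a).meanHitTime (b a) {0} / (X a).meanHitTime 0 {((a : ℕ) : ℤ)})
          atTop (𝓝 0) →
        Tendsto (fun a => (X a).meanHitTime (a : ℕ) {0} / (X a).meanHitTime 0 {b a})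
          atTop (𝓝 0) →
        EscapeAtMeanTimes (fun a => (X a).pathLaw 0)
          (fun a => hitTime {((a : ℕ) : ℤ), b a}))) ∧
    -- escape in a half well
    ((∀ a, b a = 0) → StrongDriftLeft X →
      EscapeAtMeanTimes (fun a => (X a).pathLaw 0) (fun a => hitTime {((a : ℕ) : ℤ)})) := by
  have hnn : ∀ (S : ℕ+ → Set ℤ) (z : ℕ+ → ℤ) (a : ℕ+), 0 ≤ (X a).meanHit (S a) (z a) :=
    fun S z a => (X a).meanHit_nonneg _ _
  have hright0 : ∀ᶠ a : ℕ+ in atTop, (0 : ℤ) ∉ ({((a : ℕ) : ℤ)} : Set ℤ) :=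
    Eventually.of_forall fun a => by simpa using (pnat_cast_pos a).ne
  refine ⟨fun a x hx y hy => (X a).identDistrib_timeAfterLastVisit hx hy,
    fun h => h.cutoffAtMeanTimes hb, fun hfull h => h.cutoffAtMeanTimes hb hfull,
    fun hfull h => ?_, fun hhalf h => ?_⟩
  · have hleft0 : ∀ᶠ a : ℕ+ in atTop, (0 : ℤ) ∉ ({b a} : Set ℤ) :=
      hfull.mono fun a ha => by simpa using ha.ne'
    have hr := h.1.tendsto_div hb
    have hl := h.2.tendsto_div hb hfull
    refine ⟨fun h1 => ?_, fun h2 => ?_, fun h1 h2 => ?_⟩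
    · exact escapeAtMeanTimes_of_tendsto hb X _ (fun a => .inl rfl) hright0
        (tendsto_max_div (hnn _ _) (hnn _ _) (hnn _ _) hr (tendsto_toReal_div h1))
    · exact escapeAtMeanTimes_of_tendsto hb X _ (fun a => .inr rfl) hleft0
        (tendsto_max_div (hnn _ _) (hnn _ _) (hnn _ _) (tendsto_toReal_div h2) hl)
    · refine escapeAtMeanTimes_of_tendsto hb X _ (fun a => .inl (by simp)) ?_ ?_
      · filter_upwards [hright0, hleft0] with a ha1 ha2
        simpa using ⟨ha1, ha2⟩
      · refine tendsto_max_div_of_le (A := fun a => (X a).meanHit {((a : ℕ) : ℤ)} 0)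
          (B := fun a => (X a).meanHit {b a} 0) (hnn _ _) (hnn _ _) ?_ ?_ (hnn _ _) ?_ hr
          (tendsto_toReal_div h1) (tendsto_toReal_div h2) hl
        · exact hright0.mono fun a ha => one_pos.trans_le ((X a).one_le_meanHit
            (nonempty_inter_states (right_mem_states hb a) (Set.mem_singleton _))
            (zero_mem_states hb a) ha)
        · exact hleft0.mono fun a ha => one_pos.trans_le ((X a).one_le_meanHit
            (nonempty_inter_states (left_mem_states hb a) (Set.mem_singleton _))
            (zero_mem_states hb a) ha)
        · refine Eventually.of_forall fun a => ?_
          have hA := add_nonneg ((X a).meanHit_nonneg {0} (b a))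
            ((X a).meanHit_nonneg {((a : ℕ) : ℤ)} 0)
          have hB := add_nonneg ((X a).meanHit_nonneg {0} (a : ℕ))
            ((X a).meanHit_nonneg {b a} 0)
          have := (X a).le_meanHit_pair (hb a) (pnat_cast_pos a).le (one_div_nonneg.2 hA)
            (one_div_nonneg.2 hB) (by rw [one_div_mul_eq_div]; exact div_self_le_one _)
            (by rw [one_div_mul_eq_div]; exact div_self_le_one _)
          rwa [one_div_mul_eq_div, one_div_mul_eq_div] at this
  · refine escapeAtMeanTimes_of_tendsto hb X _ (fun a => .inl rfl) hright0
      (tendsto_max_div (hnn _ _) (hnn _ _) (hnn _ _) (h.tendsto_div hb) ?_)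
    -- In a half well the left end is `0` itself, with return time zero.
    refine tendsto_const_nhds.congr fun a => ?_
    rw [(X a).meanHit_of_mem (S := {0}) (hhalf a), zero_div]
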